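/- Let $\alpha>1$ be fixed and let $\varphi:\mathbb R\to[0,\infty)$ be an even $C^\infty$ function with $\int_{-\infty}^{\infty}\varphi(x)\,dx=1$ which satisfies, with some constants $A,B,C>0$, $|x^k\varphi^{(q)}(x)|\le CA^kB^qq^{q\alpha}$ for all real $x$ and all integers $k,q\ge 0$ (with $0^0=1$); let $a>0$ be such that $\varphi(x)=0$ for $|x|\ge a$. Let $b>\max(1,a)$ and put $$\Phi(x)=\int_{x-b}^{x+b}\varphi(t)\,dt,\qquad f(x)=\int_{-\infty}^{\infty}\Phi(u)e^{-2\pi i x u}\,du$$ (so that $\Phi$ is even, $\Phi(x)=1$ for $|x|\le b-a$ and $\Phi(x)=0$ for $|x|\ge b+a$). Let $$Z(t)=\pi^{-it/2}\,\frac{\Gamma(\frac14+\frac{it}2)}{|\Gamma(\frac14+\frac{it}2)|}\,\zeta(\tfrac12+it)$$ be Hardy's function. Let $0<\delta<2\pi(b-a)$, $\varepsilon>0$ and $N\ge1$ be fixed real numbers. Then there are constants $K$ and $T_0$, depending only on $\varphi,\alpha,a,b,\delta,\varepsilon,N$, such that the following holds for all $T\ge T_0$. Put $G=\delta/\log(T/2\pi)$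 and $L=(\log T)^{1/2+\varepsilon}$. For every real $V$ with $(\log T)^\varepsilon\le V\le T^{1/4}/\log T$ and every real $t$ with $|t-T|\le VL$, the integral $$M_{Z,f}(t)=\int_{-\infty}^{\infty}Z(t+x)\,f(x/G)\,dx$$ converges absolutely, and $$|M_{Z,f}(t)-G\,Z(t)|\le K\,G\,T^{-N};$$ that is, $M_{Z,f}(t)=G\bigl(Z(t)+O(T^{-N})\bigr)$. -/

import Mathlib

open MeasureTheory
open scoped ContDiff FourierTransform

noncomputable section

/-- The Gelfand–Shilov class `S_α^β`: smooth functions with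
`|x^k f^(q)(x)| ≤ C A^k B^q k^(kα) q^(qβ)` for all `k, q ≥ 0` and all real `x`
(with the convention `0 ^ 0 = 1`). -/
def GelfandShilov (α β : ℝ) (f : ℝ → ℝ) : Prop :=
  ContDiff ℝ ∞ f ∧ ∃ A B C : ℝ, 0 < A ∧ 0 < B ∧ 0 < C ∧ ∀ (k q : ℕ) (x : ℝ),
    |x ^ k * iteratedDeriv q f x| ≤
      C * A ^ k * B ^ q * (k : ℝ) ^ ((k : ℝ) * α) * (q : ℝ) ^ ((q : ℝ) * β)

/-- The function `Φ(x) = ∫_{x-b}^{x+b} φ(t) dt`. -/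
def plateau (φ : ℝ → ℝ) (b : ℝ) (x : ℝ) : ℝ := ∫ t in (x - b)..(x + b), φ t

/-- The Fourier transform `f(x) = ∫ Φ(u) e^{-2πixu} du` of `Φ`. -/
def plateauFourier (φ : ℝ → ℝ) (b : ℝ) : ℝ → ℂ := 𝓕 (fun u : ℝ => (plateau φ b u : ℂ))

/-- Hardy's function `Z(t) = χ(1/2+it)^{-1/2} ζ(1/2+it)`, where `ζ(s) = χ(s) ζ(1-s)`, that is
`Z(t) = π^{-it/2} Γ(1/4+it/2) ζ(1/2+it) / |Γ(1/4+it/2)|`. (Its values are real.) -/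
def hardyZ (t : ℝ) : ℂ :=
  (Real.pi : ℂ) ^ (-(Complex.I * t / 2)) * Complex.Gamma (1 / 4 + Complex.I * t / 2) *
    riemannZeta (1 / 2 + Complex.I * t) / (‖Complex.Gamma (1 / 4 + Complex.I * t / 2)‖ : ℂ)

/-- The convolution `M_{Z,f}(t) = ∫ Z(t+x) f(x/G) dx`. -/
def convZ (f : ℝ → ℂ) (G t : ℝ) : ℂ := ∫ x : ℝ, hardyZ (t + x) * f (x / G)

end

/-!
Hardy's function `Z(t + x)`, as a function of `x`, behaves near `t ≈ T` like a function of
exponential type about `½ log (T / 2π)`, while `Φ = 1` on `[-(b - a), b - a]`; convolution with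
`f(·/G)` acts on frequency `ω` as multiplication by `G Φ(Gω / 2π)`, and `δ < 2π(b - a)` puts all
the relevant frequencies on the plateau, so that it reproduces `G Z(t)`.

This is made rigorous by a contour shift. From `Φ' = φ(· + b) - φ(· - b)` one gets
`f(w) = φ̂(w) (e^{2πibw} - e^{-2πibw}) / (2πiw)` (`mul_plateauFourier`), and Fourier inversion gives
`∫ f(x/G) dx = G Φ(0) = G`. Hence `M(t) - G Z(t) = ∫ (Z(t + x) - Z(t)) f(x/G) dx`
(`convZ_sub_eq`). The range `|x| > t/2` is negligible because `f` decays faster than any power and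
`Z` grows at most linearly (`exists_norm_tail_le`). On `|x| ≤ t/2` the quotient
`(Z(t + x) - Z(t)) / x` continues holomorphically, so each of the two exponentials can be moved into
the half-plane where it decays; as `Z` is real and `φ̂` is real on the real line, the two terms are
complex conjugates, and only the shift down to `im = -Y` has to be treated
(`exists_norm_central_le`). There `φ̂(z/G) e^{-2πibz/G}` has size at most
`e^{-2π(b - a)Y/G} ≤ (T/2π)^{-Y}`, whereas `Z` is `O(T^{Y/2 + 2})`; a large fixed `Y` gives any power
saving. On the vertical sides the decay of `φ̂`, uniform in the strip, suffices.

The growth of `Z` in the strip (`exists_hardyZ_continuation`) needs two inputs: `ζ(s) = O(|s|)` for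
`re s ≥ 1/2`, from `ζ(s) = s/(s - 1) - s ∫ {x} x^{-s-1} dx`, and a polynomial bound for
`Γ(1/4 + h + iv) / Γ(1/4 - h + iv)`. The latter uses the reflection formula and the monotonicity of
`σ ↦ |Γ(σ + iv)| / Γ(σ)`, which reduces everything to the half-integers, where `|Γ(1/2 + m + iv)|`
is explicit; no form of Stirling's formula is needed.
-/

/-! ### The Riemann zeta function to the right of the critical line -/

open Set Filter Topology Asymptotics in
/-- Up to `s ↦ -s` the integral is the Mellin transform of `x ↦ {x}` restricted to `(1, ∞)`. -/
lemma differentiableAt_mellin_fract (s : ℂ) (hs : 0 < s.re) :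
    DifferentiableAt ℂ (fun s : ℂ => ∫ x : ℝ in Ioi 1, ((Int.fract x : ℝ) : ℂ) * (x : ℂ) ^ (-s - 1)) s := by
  set g : ℝ → ℂ := (Ioi (1 : ℝ)).indicator (fun x => ((Int.fract x : ℝ) : ℂ)) with hg
  have hmeas : Measurable g :=
    (Complex.measurable_ofReal.comp measurable_fract).indicator measurableSet_Ioi
  have hbd : ∀ x, ‖g x‖ ≤ 1 := by
    intro x
    rw [hg, indicator_apply]
    split_ifs
    · rw [Complex.norm_real, Real.norm_of_nonneg (Int.fract_nonneg x)]
      exact (Int.fract_lt_one x).le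
    · simp
  have hmel : (fun s : ℂ => ∫ x : ℝ in Ioi 1, ((Int.fract x : ℝ) : ℂ) * (x : ℂ) ^ (-s - 1)) =
      fun s => mellin g (-s) := by
    funext s
    simp only [mellin, hg]
    have : (fun t : ℝ => (t : ℂ) ^ (-s - 1) • (Ioi (1 : ℝ)).indicator
        (fun x => ((Int.fract x : ℝ) : ℂ)) t) = (Ioi (1 : ℝ)).indicator
        (fun x => ((Int.fract x : ℝ) : ℂ) * (x : ℂ) ^ (-s - 1)) := by
      funext t
      by_cases ht : t ∈ Ioi (1 : ℝ)
      · simp only [indicator_of_mem ht, smul_eq_mul, mul_comm]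
      · simp only [indicator_of_notMem ht, smul_zero]
    rw [this, setIntegral_indicator measurableSet_Ioi,
      inter_eq_right.2 (Ioi_subset_Ioi zero_le_one)]
  rw [hmel]
  have hloc : LocallyIntegrableOn g (Ioi 0) := by
    apply LocallyIntegrable.locallyIntegrableOn
    refine (locallyIntegrable_const (1 : ℝ)).mono hmeas.aestronglyMeasurable ?_
    exact Eventually.of_forall fun x => by simpa using hbd x
  have : DifferentiableAt ℂ (mellin g) (-s) := by
    -- `g` vanishes on `(0, 1]`, so the exponent at `0` may be any number below `-re s`.
    refine mellin_differentiableAt_of_isBigO_rpow (a := 0) (b := -s.re - 1) hloc ?_ ?_ ?_ ?_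
    · refine IsBigO.of_bound 1 (Eventually.of_forall fun x => ?_)
      simpa using hbd x
    · simpa using hs
    · refine IsBigO.of_bound 1 ?_
      have : Iio (1 : ℝ) ∈ 𝓝[>] (0 : ℝ) := mem_nhdsWithin_of_mem_nhds (Iio_mem_nhds one_pos)
      filter_upwards [this] with x hx
      rw [hg, indicator_of_notMem (by simpa using (mem_Iio.1 hx).le)]
      simp
    · simp
  exact DifferentiableAt.comp (g := mellin g) (f := fun z => -z) s this differentiableAt_id.neg

open Set in
/-- Abel summation against `⌊x⌋ = x - {x}`. -/
lemma riemannZeta_eq_fract_integral_of_one_lt_re (s : ℂ) (hs : 1 < s.re) :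
    riemannZeta s = s / (s - 1) -
      s * ∫ x : ℝ in Ioi 1, ((Int.fract x : ℝ) : ℂ) * (x : ℂ) ^ (-s - 1) := by
  have hs1 : s - 1 ≠ 0 := by
    intro h
    have := congrArg Complex.re h
    simp at this
    linarith
  have h1 : riemannZeta s = s * ∫ x : ℝ in Ioi 1, (⌊x⌋₊ : ℂ) * (x : ℂ) ^ (-(s + 1)) := by
    rw [← LSeries_one_eq_riemannZeta hs]
    have := LSeries_eq_mul_integral_of_nonneg (fun _ => 1) (r := 1) zero_le_one hs
      (by simpa using Asymptotics.isBigO_refl _ _) (by simp)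
    have h2 : LSeries (fun _ => 1) s =
        s * ∫ x : ℝ in Ioi 1, (⌊x⌋₊ : ℂ) * (x : ℂ) ^ (-(s + 1)) := by simpa using this
    exact h2
  have hint : IntegrableOn (fun x : ℝ => (x : ℂ) ^ (-s)) (Ioi 1) :=
    integrableOn_Ioi_cpow_of_lt (by simpa using hs) one_pos
  have hfr : IntegrableOn (fun x : ℝ => ((Int.fract x : ℝ) : ℂ) * (x : ℂ) ^ (-s - 1)) (Ioi 1) := by
    have h2 : IntegrableOn (fun x : ℝ => (x : ℂ) ^ (-s - 1)) (Ioi 1) :=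
      integrableOn_Ioi_cpow_of_lt (by simp; linarith) one_pos
    refine Integrable.bdd_mul (c := 1) h2
      (Complex.measurable_ofReal.comp measurable_fract).aestronglyMeasurable
      (Filter.Eventually.of_forall fun x => ?_)
    rw [Complex.norm_real, Real.norm_of_nonneg (Int.fract_nonneg x)]
    exact (Int.fract_lt_one x).le
  have h3 : ∫ x : ℝ in Ioi 1, (⌊x⌋₊ : ℂ) * (x : ℂ) ^ (-(s + 1)) =
      (∫ x : ℝ in Ioi 1, (x : ℂ) ^ (-s)) -
        ∫ x : ℝ in Ioi 1, ((Int.fract x : ℝ) : ℂ) * (x : ℂ) ^ (-s - 1) := by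
    rw [← integral_sub hint hfr]
    refine setIntegral_congr_fun measurableSet_Ioi fun x hx => ?_
    have hx0 : (0 : ℝ) < x := zero_lt_one.trans hx
    have hxc : (x : ℂ) ≠ 0 := by exact_mod_cast hx0.ne'
    have hfl : ((⌊x⌋₊ : ℕ) : ℂ) = (x : ℂ) - (Int.fract x : ℝ) := by
      have : ((⌊x⌋₊ : ℕ) : ℝ) = x - Int.fract x := by
        rw [natCast_floor_eq_intCast_floor hx0.le, Int.self_sub_fract]
      exact_mod_cast this
    have hp : (x : ℂ) ^ (-s) = x * (x : ℂ) ^ (-s - 1) := by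
      rw [Complex.cpow_sub _ _ hxc, Complex.cpow_one]
      field_simp
    simp only [hfl, hp]
    rw [show -(s + 1) = -s - 1 by ring]
    ring
  rw [h1, h3, integral_Ioi_cpow_of_lt (by simpa using hs) one_pos]
  have hs2 : -s + 1 ≠ 0 := by
    intro h; apply hs1; linear_combination -h
  simp only [Complex.ofReal_one, Complex.one_cpow]
  rw [mul_sub]
  congr 1
  field_simp
  ring

open Set in
/-- Analytic continuation of `riemannZeta_eq_fract_integral_of_one_lt_re` to `0 < re s`. -/
lemma riemannZeta_eq_fract_integral (s : ℂ) (hs : 0 < s.re) (hs1 : s ≠ 1) :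
    riemannZeta s = s / (s - 1) -
      s * ∫ x : ℝ in Ioi 1, ((Int.fract x : ℝ) : ℂ) * (x : ℂ) ^ (-s - 1) := by
  set J : ℂ → ℂ := fun s => ∫ x : ℝ in Ioi 1, ((Int.fract x : ℝ) : ℂ) * (x : ℂ) ^ (-s - 1) with hJ
  -- Multiplying by `s - 1` makes both sides holomorphic on the half-plane `0 < re s`.
  set U : Set ℂ := {z | 0 < z.re}
  have hU : IsOpen U := isOpen_lt continuous_const Complex.continuous_re
  have hUc : IsPreconnected U := (convex_halfSpace_re_gt 0).isPreconnected
  have h1 : AnalyticOnNhd ℂ riemannZeta₁ U :=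
    DifferentiableOn.analyticOnNhd differentiable_riemannZeta₁.differentiableOn hU
  have h2 : AnalyticOnNhd ℂ (fun z => z - (z - 1) * z * J z) U := by
    refine DifferentiableOn.analyticOnNhd (fun z hz => ?_) hU
    have := differentiableAt_mellin_fract z hz
    exact (differentiableAt_id.sub (((differentiableAt_id.sub_const 1).mul
      differentiableAt_id).mul this)).differentiableWithinAt
  have h2U : (2 : ℂ) ∈ U := by simp [U]
  have heq : EqOn riemannZeta₁ (fun z => z - (z - 1) * z * J z) U := by
    refine h1.eqOn_of_preconnected_of_eventuallyEq h2 hUc h2U ?_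
    have : {z : ℂ | 1 < z.re} ∈ nhds (2 : ℂ) :=
      (isOpen_lt continuous_const Complex.continuous_re).mem_nhds (by simp)
    filter_upwards [this] with z hz
    have hz1 : z - 1 ≠ 0 := by
      intro h
      have := congrArg Complex.re h
      simp at this
      have hz' : 1 < z.re := hz
      linarith
    have e1 := riemannZeta_eq_fract_integral_of_one_lt_re z hz
    rw [riemannZeta_eq_inv_sub_mul (sub_ne_zero.1 hz1)] at e1
    have : riemannZeta₁ z = (z - 1) * ((z - 1)⁻¹ * riemannZeta₁ z) := by field_simp
    rw [this, e1]
    simp only [hJ]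
    field_simp
  have hs2 : s - 1 ≠ 0 := sub_ne_zero.2 hs1
  rw [riemannZeta_eq_inv_sub_mul hs1, heq hs]
  change _ = s / (s - 1) - s * J s
  field_simp

open Set in
lemma norm_riemannZeta_le (s : ℂ) (hs : 1 / 2 ≤ s.re) (hs1 : 1 / 2 ≤ ‖s - 1‖) :
    ‖riemannZeta s‖ ≤ 4 * ‖s‖ := by
  have hs0 : s ≠ 1 := by
    rintro rfl
    norm_num at hs1
  rw [riemannZeta_eq_fract_integral s (by linarith) hs0]
  have hI : ‖∫ x : ℝ in Ioi 1, ((Int.fract x : ℝ) : ℂ) * (x : ℂ) ^ (-s - 1)‖ ≤ 2 := by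
    calc _ ≤ ∫ x : ℝ in Ioi 1, x ^ (-(3 / 2) : ℝ) := by
            refine norm_integral_le_of_norm_le
              (integrableOn_Ioi_rpow_of_lt (by norm_num) one_pos) ?_
            filter_upwards [ae_restrict_mem measurableSet_Ioi] with x hx
            have hx0 : (0 : ℝ) < x := zero_lt_one.trans hx
            rw [norm_mul, Complex.norm_real, Real.norm_of_nonneg (Int.fract_nonneg x),
              Complex.norm_cpow_eq_rpow_re_of_pos hx0]
            calc _ ≤ 1 * x ^ (-(3 / 2) : ℝ) := by
                  refine mul_le_mul (Int.fract_lt_one x).le ?_ (by positivity) zero_le_one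
                  refine Real.rpow_le_rpow_of_exponent_le (le_of_lt hx) ?_
                  simp
                  linarith
              _ = _ := one_mul _
      _ = 2 := by
            rw [integral_Ioi_rpow_of_lt (by norm_num) one_pos]
            norm_num
  have hd : ‖s / (s - 1)‖ ≤ 2 * ‖s‖ := by
    rw [norm_div, div_le_iff₀ (by linarith)]
    nlinarith [norm_nonneg s]
  calc _ ≤ ‖s / (s - 1)‖ + ‖s‖ * ‖∫ x : ℝ in Ioi 1, ((Int.fract x : ℝ) : ℂ) * (x : ℂ) ^ (-s - 1)‖ := by
        rw [← norm_mul]; exact norm_sub_le _ _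
    _ ≤ 2 * ‖s‖ + ‖s‖ * 2 := by gcongr
    _ = _ := by ring

/-! ### Gamma quotients on horizontal lines -/

/-- On a horizontal line, `‖Γ(σ + iv)‖ / Γ(σ)` is a nondecreasing function of `σ > 0`: by Gauss's
limit formula it is the product of the increasing factors `(σ + j) / ‖σ + j + iv‖`. -/
lemma norm_Gamma_mul_Gamma_le {σ τ : ℝ} (hσ : 0 < σ) (hστ : σ ≤ τ) (v : ℝ) :
    ‖Complex.Gamma (σ + v * Complex.I)‖ * Real.Gamma τ ≤
      ‖Complex.Gamma (τ + v * Complex.I)‖ * Real.Gamma σ := by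
  have hτ : 0 < τ := hσ.trans_le hστ
  have key : ∀ n : ℕ, n ≠ 0 →
      ‖Complex.GammaSeq (σ + v * Complex.I) n‖ * ‖Complex.GammaSeq τ n‖ ≤
        ‖Complex.GammaSeq (τ + v * Complex.I) n‖ * ‖Complex.GammaSeq σ n‖ := by
    intro n hn
    have hn0 : 0 < n := Nat.pos_of_ne_zero hn
    have hnum : ∀ s : ℂ, ‖Complex.GammaSeq s n‖ =
        (n : ℝ) ^ s.re * (n.factorial : ℝ) / ∏ j ∈ Finset.range (n + 1), ‖s + j‖ := by
      intro s
      rw [Complex.GammaSeq, norm_div, norm_mul, Complex.norm_natCast_cpow_of_pos hn0,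
        Complex.norm_natCast, norm_prod]
    have hnorm : ∀ (r : ℝ) (j : ℕ),
        ‖(r : ℂ) + v * Complex.I + j‖ = Real.sqrt ((r + j) ^ 2 + v ^ 2) := by
      intro r j
      rw [← Complex.norm_add_mul_I]
      congr 1
      push_cast
      ring
    have hnorm' : ∀ (r : ℝ) (j : ℕ), 0 < r → ‖(r : ℂ) + j‖ = r + j := by
      intro r j hr
      rw [← Complex.ofReal_natCast, ← Complex.ofReal_add, Complex.norm_real,
        Real.norm_of_nonneg (by positivity)]
    have hre : ∀ r : ℝ, ((r : ℂ) + v * Complex.I).re = r := by intro r; simp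
    simp only [hnum, hre, Complex.ofReal_re]
    rw [div_mul_div_comm, div_mul_div_comm, ← Finset.prod_mul_distrib, ← Finset.prod_mul_distrib,
      show (n : ℝ) ^ τ * (n.factorial : ℝ) * ((n : ℝ) ^ σ * (n.factorial : ℝ)) =
        (n : ℝ) ^ σ * (n.factorial : ℝ) * ((n : ℝ) ^ τ * (n.factorial : ℝ)) by ring]
    have hpos : 0 < ∏ j ∈ Finset.range (n + 1), ‖(τ : ℂ) + v * Complex.I + j‖ * ‖(σ : ℂ) + j‖ := by
      refine Finset.prod_pos fun j _ => ?_
      rw [hnorm, hnorm' _ _ hσ]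
      positivity
    refine div_le_div_of_nonneg_left (by positivity) hpos ?_
    refine Finset.prod_le_prod (fun j _ => by positivity) fun j _ => ?_
    rw [hnorm, hnorm, hnorm' _ _ hσ, hnorm' _ _ hτ]
    have hp : 0 < σ + j := by positivity
    have hq : 0 < τ + j := by positivity
    have hpq : (σ + j) ^ 2 ≤ (τ + j) ^ 2 := by gcongr
    rw [← Real.sqrt_sq hp.le, ← Real.sqrt_sq hq.le, ← Real.sqrt_mul (by positivity),
      ← Real.sqrt_mul (by positivity), Real.sqrt_sq hp.le, Real.sqrt_sq hq.le]
    apply Real.sqrt_le_sqrt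
    nlinarith [sq_nonneg v]
  have hlim := le_of_tendsto_of_tendsto
    ((Complex.GammaSeq_tendsto_Gamma (σ + v * Complex.I)).norm.mul
      (Complex.GammaSeq_tendsto_Gamma τ).norm)
    ((Complex.GammaSeq_tendsto_Gamma (τ + v * Complex.I)).norm.mul
      (Complex.GammaSeq_tendsto_Gamma σ).norm)
    (by filter_upwards [Filter.eventually_ne_atTop 0] with n hn using key n hn)
  rwa [Complex.Gamma_ofReal, Complex.Gamma_ofReal, Complex.norm_real, Complex.norm_real,
    Real.norm_of_nonneg (Real.Gamma_pos_of_pos hτ).le,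
    Real.norm_of_nonneg (Real.Gamma_pos_of_pos hσ).le] at hlim

lemma norm_Gamma_conj_im (σ v : ℝ) :
    ‖Complex.Gamma (σ - v * Complex.I)‖ = ‖Complex.Gamma (σ + v * Complex.I)‖ := by
  have : (σ : ℂ) - v * Complex.I = (starRingEnd ℂ) (σ + v * Complex.I) := by
    simp [sub_eq_add_neg]
  rw [this, Complex.Gamma_conj, RCLike.norm_conj]

lemma norm_sin_le_cosh (x y : ℝ) : ‖Complex.sin (x + y * Complex.I)‖ ≤ Real.cosh y := by
  rw [Complex.sin, norm_div, norm_mul, Complex.norm_I, mul_one, Complex.norm_two, Real.cosh_eq]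
  gcongr
  refine (norm_sub_le _ _).trans (le_of_eq ?_)
  rw [Complex.norm_exp, Complex.norm_exp]
  simp

/-- The case `m = 0` is an equality, by the reflection formula; the recurrence gives the rest. -/
lemma norm_Gamma_half_add_nat_sq_le (m : ℕ) (v : ℝ) :
    ‖Complex.Gamma ((1 / 2 + m : ℝ) + v * Complex.I)‖ ^ 2 * Real.cosh (Real.pi * v) ≤
      (m + |v|) ^ (2 * m) * Real.pi := by
  induction m with
  | zero =>
    have h := Complex.Gamma_mul_Gamma_one_sub ((1 / 2 : ℝ) + v * Complex.I)
    have h1 : 1 - (((1 / 2 : ℝ) : ℂ) + v * Complex.I) = ((1 / 2 : ℝ) : ℂ) - v * Complex.I := by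
      push_cast; ring
    have h2 : Complex.sin (Real.pi * (((1 / 2 : ℝ) : ℂ) + v * Complex.I)) =
        (Real.cosh (Real.pi * v) : ℝ) := by
      rw [show (Real.pi : ℂ) * (((1 / 2 : ℝ) : ℂ) + v * Complex.I) =
        ((Real.pi * v : ℝ) : ℂ) * Complex.I + Real.pi / 2 by push_cast; ring,
        Complex.sin_add_pi_div_two, Complex.cos_mul_I, Complex.ofReal_cosh]
    rw [h1, h2] at h
    have hn := congrArg norm h
    rw [norm_mul, norm_Gamma_conj_im, norm_div, Complex.norm_real, Complex.norm_real,
      Real.norm_of_nonneg Real.pi_pos.le, Real.norm_of_nonneg (Real.cosh_pos _).le,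
      eq_div_iff (Real.cosh_pos _).ne'] at hn
    simp only [Nat.cast_zero, add_zero, mul_zero, pow_zero, one_mul]
    rw [sq]
    exact hn.le
  | succ m ih =>
    have e : (((1 / 2 + (m + 1 : ℕ) : ℝ) : ℂ) + v * Complex.I) =
        (((1 / 2 + m : ℝ) : ℂ) + v * Complex.I) + 1 := by push_cast; ring
    have hne : (((1 / 2 + m : ℝ) : ℂ) + v * Complex.I) ≠ 0 := by
      intro h
      have := congrArg Complex.re h
      simp at this
      have hm : (0 : ℝ) ≤ m := Nat.cast_nonneg m
      linarith
    have hs : ‖(((1 / 2 + m : ℝ) : ℂ) + v * Complex.I)‖ ≤ (m + 1 : ℕ) + |v| := by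
      refine (norm_add_le _ _).trans ?_
      rw [Complex.norm_real, Real.norm_of_nonneg (by positivity), norm_mul, Complex.norm_real,
        Complex.norm_I, mul_one, Real.norm_eq_abs]
      push_cast
      linarith
    rw [e, Complex.Gamma_add_one _ hne, norm_mul, mul_pow, mul_assoc]
    calc _ ≤ (((m + 1 : ℕ) : ℝ) + |v|) ^ 2 * ((m + |v|) ^ (2 * m) * Real.pi) :=
          mul_le_mul (by gcongr) ih (by have := Real.cosh_pos (Real.pi * v); positivity)
            (by positivity)
      _ ≤ (((m + 1 : ℕ) : ℝ) + |v|) ^ 2 * ((((m + 1 : ℕ) : ℝ) + |v|) ^ (2 * m) * Real.pi) := by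
          have := Real.pi_pos
          gcongr
          simp
      _ = _ := by ring

/-- A polynomial bound for the quotient of two Gamma values at height `v` whose real parts are
symmetric about `1/4`. By the reflection formula the quotient is
`Γ(1/4 + h + iv) Γ(3/4 + h - iv) sin π(1/4 - h + iv) / π`, and by monotonicity in the real part
both Gamma factors are at most a constant times `‖Γ(M + 3/2 + iv)‖`. -/
lemma exists_norm_Gamma_le_norm_Gamma_reflected (M : ℕ) :
    ∃ C : ℝ, 0 ≤ C ∧ ∀ h : ℝ, 0 ≤ h → h ≤ M → ∀ v : ℝ, v ≠ 0 →
      ‖Complex.Gamma ((1 / 4 + h : ℝ) + v * Complex.I)‖ ≤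
        C * (M + 1 + |v|) ^ (2 * (M + 1)) *
          ‖Complex.Gamma ((1 / 4 - h : ℝ) + v * Complex.I)‖ := by
  obtain ⟨K, hK⟩ : ∃ K, ∀ σ ∈ Set.Icc (1 / 4 : ℝ) (1 / 2 + (M + 1 : ℕ)), Real.Gamma σ ≤ K := by
    have hc : ContinuousOn Real.Gamma (Set.Icc (1 / 4 : ℝ) (1 / 2 + (M + 1 : ℕ))) := by
      intro σ hσ
      refine (Real.differentiableAt_Gamma fun n => ?_).continuousAt.continuousWithinAt
      have := hσ.1
      have hn : (0 : ℝ) ≤ n := Nat.cast_nonneg n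
      linarith
    obtain ⟨K, hK⟩ := isCompact_Icc.bddAbove_image hc
    exact ⟨K, fun σ hσ => hK ⟨σ, hσ, rfl⟩⟩
  set τ : ℝ := 1 / 2 + (M + 1 : ℕ) with hτ
  have hτ0 : 0 < τ := by positivity
  have hΓτ : 0 < Real.Gamma τ := Real.Gamma_pos_of_pos hτ0
  have hτ1 : 1 / 4 ≤ τ := by
    rw [hτ]
    linarith [(Nat.cast_nonneg (M + 1) : (0 : ℝ) ≤ (M + 1 : ℕ))]
  have hK0 : 0 ≤ K := hΓτ.le.trans (hK τ ⟨hτ1, le_rfl⟩)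
  have hline : ∀ σ v : ℝ, 1 / 4 ≤ σ → σ ≤ τ → ‖Complex.Gamma (σ + v * Complex.I)‖ ≤
      K / Real.Gamma τ * ‖Complex.Gamma (τ + v * Complex.I)‖ := by
    intro σ v h1 h2
    have := norm_Gamma_mul_Gamma_le (by linarith) h2 v
    rw [div_mul_eq_mul_div, le_div_iff₀ hΓτ]
    refine this.trans ?_
    rw [mul_comm]
    exact mul_le_mul_of_nonneg_right (hK σ ⟨h1, h2⟩) (norm_nonneg _)
  refine ⟨(K / Real.Gamma τ) ^ 2, by positivity, fun h h0 hM v hv => ?_⟩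
  set g := ‖Complex.Gamma (τ + v * Complex.I)‖
  set z : ℂ := (1 / 4 - h : ℝ) + v * Complex.I with hz
  have hzim : z.im = v := by simp [hz]
  have e1 : 1 - z = ((3 / 4 + h : ℝ) : ℂ) - v * Complex.I := by
    rw [hz]; push_cast; ring
  have hrefl := Complex.Gamma_mul_Gamma_one_sub z
  have hsin : Complex.sin (Real.pi * z) ≠ 0 := by
    rw [Complex.sin_ne_zero_iff]
    intro k hk
    have := congrArg Complex.im hk
    simp [hzim, hv] at this
  rw [eq_div_iff hsin, e1] at hrefl
  have hn := congrArg norm hrefl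
  rw [norm_mul, norm_mul, norm_Gamma_conj_im, Complex.norm_real,
    Real.norm_of_nonneg Real.pi_pos.le] at hn
  have hM1 : ((M + 1 : ℕ) : ℝ) = M + 1 := by push_cast; ring
  have b1 := hline (1 / 4 + h) v (by linarith) (by rw [hτ, hM1]; linarith)
  have b2 := hline (3 / 4 + h) v (by linarith) (by rw [hτ, hM1]; linarith)
  have b3 : ‖Complex.sin (Real.pi * z)‖ ≤ Real.cosh (Real.pi * v) := by
    have : (Real.pi : ℂ) * z = ((Real.pi * (1 / 4 - h) : ℝ) : ℂ) +
        ((Real.pi * v : ℝ) : ℂ) * Complex.I := by rw [hz]; push_cast; ring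
    rw [this]
    exact norm_sin_le_cosh _ _
  have b4 := norm_Gamma_half_add_nat_sq_le (M + 1) v
  rw [hM1, ← hM1, ← hτ, hM1] at b4
  set k := K / Real.Gamma τ
  have hk : 0 ≤ k := by positivity
  have hg : 0 ≤ g := norm_nonneg _
  have hch := Real.cosh_pos (Real.pi * v)
  refine le_of_mul_le_mul_right ?_ Real.pi_pos
  calc ‖Complex.Gamma ((1 / 4 + h : ℝ) + v * Complex.I)‖ * Real.pi
      = ‖Complex.Gamma ((1 / 4 + h : ℝ) + v * Complex.I)‖ *
        (‖Complex.Gamma z‖ * ‖Complex.Gamma ((3 / 4 + h : ℝ) + v * Complex.I)‖ *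
          ‖Complex.sin (Real.pi * z)‖) := by rw [hn]
    _ ≤ (k * g) * (‖Complex.Gamma z‖ * (k * g) * Real.cosh (Real.pi * v)) := by gcongr
    _ = k ^ 2 * ‖Complex.Gamma z‖ * (g ^ 2 * Real.cosh (Real.pi * v)) := by ring
    _ ≤ k ^ 2 * ‖Complex.Gamma z‖ * ((M + 1 + |v|) ^ (2 * (M + 1)) * Real.pi) := by gcongr
    _ = _ := by ring

/-! ### Holomorphic continuation of Hardy's function -/

open ComplexConjugate

/-- A nonvanishing holomorphic function on a disc has a holomorphic logarithm. -/
lemma exists_holomorphic_log_on_ball {g : ℂ → ℂ} {c : ℂ} {r : ℝ} (hr : 0 < r)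
    (hg : DifferentiableOn ℂ g (Metric.ball c r)) (h0 : ∀ z ∈ Metric.ball c r, g z ≠ 0) :
    ∃ l : ℂ → ℂ, DifferentiableOn ℂ l (Metric.ball c r) ∧
      ∀ z ∈ Metric.ball c r, Complex.exp (l z) = g z := by
  have hdg : DifferentiableOn ℂ (fun z => deriv g z / g z) (Metric.ball c r) :=
    (hg.deriv Metric.isOpen_ball).div hg h0
  obtain ⟨l, hlc, hl⟩ := hdg.isExactOn_ball.with_val_at c (Complex.log (g c))
  refine ⟨l, fun z hz => (hl z hz).differentiableAt.differentiableWithinAt, fun z hz => ?_⟩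
  have hc : c ∈ Metric.ball c r := Metric.mem_ball_self hr
  have hder : ∀ w ∈ Metric.ball c r,
      HasDerivAt (fun w => g w * Complex.exp (-l w)) 0 w := by
    intro w hw
    have h1 : HasDerivAt g (deriv g w) w :=
      (hg.differentiableAt (Metric.isOpen_ball.mem_nhds hw)).hasDerivAt
    have h2 := h1.mul (hl w hw).neg.cexp
    refine h2.congr_deriv ?_
    have hq : g w * (deriv g w / g w) = deriv g w := mul_div_cancel₀ _ (h0 w hw)
    linear_combination -Complex.exp (-l w) * hq
  have hconst : g z * Complex.exp (-l z) = g c * Complex.exp (-l c) :=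
    Metric.isOpen_ball.is_const_of_deriv_eq_zero (convex_ball c r).isPreconnected
      (fun w hw => (hder w hw).differentiableAt.differentiableWithinAt)
      (fun w hw => (hder w hw).deriv) hz hc
  -- `g e^{-l}` is constant, and equal to `1` at the centre since `l c = log (g c)`.
  rw [hlc, Complex.exp_neg, Complex.exp_neg, Complex.exp_log (h0 c hc),
    mul_inv_cancel₀ (h0 c hc)] at hconst
  exact (mul_inv_eq_one₀ (Complex.exp_ne_zero _)).1 hconst |>.symm


lemma quarter_add_ne_neg_nat_of_re_pos {s : ℂ} (hs : 0 < s.re) (m : ℕ) :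
    1 / 4 + Complex.I * s / 2 ≠ -m := by
  intro h
  have := congrArg Complex.im h
  simp at this
  linarith

lemma quarter_add_ne_neg_nat_of_real (u : ℝ) (m : ℕ) :
    1 / 4 + Complex.I * u / 2 ≠ -m := by
  intro h
  have := congrArg Complex.re h
  simp at this
  have hm : (0 : ℝ) ≤ m := Nat.cast_nonneg m
  linarith

lemma half_add_ne_one_of_real (u : ℝ) : 1 / 2 + Complex.I * (u : ℂ) ≠ 1 := by
  intro h
  have := congrArg Complex.re h
  norm_num at this

lemma continuous_hardyZ : Continuous hardyZ := by
  unfold hardyZ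
  have hΓ : Continuous fun t : ℝ => Complex.Gamma (1 / 4 + Complex.I * t / 2) := by
    refine continuous_iff_continuousAt.2 fun t => ?_
    have h1 : ContinuousAt Complex.Gamma (1 / 4 + Complex.I * t / 2) :=
      (Complex.differentiableAt_Gamma _ (quarter_add_ne_neg_nat_of_real t)).continuousAt
    exact ContinuousAt.comp (f := fun t : ℝ => 1 / 4 + Complex.I * (t : ℂ) / 2) h1
      (by fun_prop)
  have hζ : Continuous fun t : ℝ => riemannZeta (1 / 2 + Complex.I * t) := by
    refine continuous_iff_continuousAt.2 fun t => ?_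
    have h1 : ContinuousAt riemannZeta (1 / 2 + Complex.I * t) :=
      (differentiableAt_riemannZeta (half_add_ne_one_of_real t)).continuousAt
    exact ContinuousAt.comp (f := fun t : ℝ => 1 / 2 + Complex.I * (t : ℂ)) h1
      (by fun_prop)
  have hπ : Continuous fun t : ℝ => (Real.pi : ℂ) ^ (-(Complex.I * t / 2)) := by
    refine Continuous.const_cpow (by fun_prop) (Or.inl ?_)
    exact_mod_cast Real.pi_ne_zero
  refine ((hπ.mul hΓ).mul hζ).div (by fun_prop) fun t => ?_
  exact_mod_cast norm_ne_zero_iff.2 (Complex.Gamma_ne_zero (quarter_add_ne_neg_nat_of_real t))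

lemma norm_hardyZ_le (u : ℝ) : ‖hardyZ u‖ ≤ 4 * (1 + |u|) := by
  have hΓ : ‖Complex.Gamma (1 / 4 + Complex.I * u / 2)‖ ≠ 0 :=
    norm_ne_zero_iff.2 (Complex.Gamma_ne_zero (quarter_add_ne_neg_nat_of_real u))
  have h1 : ‖hardyZ u‖ = ‖riemannZeta (1 / 2 + Complex.I * u)‖ := by
    rw [hardyZ, norm_div, norm_mul, norm_mul, Complex.norm_real, norm_norm,
      Complex.norm_cpow_eq_rpow_re_of_pos Real.pi_pos]
    simp only [Complex.neg_re, Complex.div_ofNat_re, Complex.mul_re, Complex.I_re,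
      Complex.ofReal_re, zero_mul, Complex.I_im, Complex.ofReal_im, mul_zero, sub_self, zero_div,
      neg_zero, Real.rpow_zero, one_mul]
    exact mul_div_cancel_left₀ _ hΓ
  rw [h1]
  refine (norm_riemannZeta_le _ (by simp) ?_).trans ?_
  · refine le_trans ?_ (Complex.abs_re_le_norm _)
    norm_num
  · gcongr
    refine (norm_add_le _ _).trans ?_
    simp only [norm_mul, Complex.norm_I, one_mul, Complex.norm_real, Real.norm_eq_abs]
    norm_num

/-- Hardy's function is real on the real line: this is the functional equation, since
`1 - s = conj s` on the critical line. -/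
lemma conj_hardyZ (u : ℝ) : conj (hardyZ u) = hardyZ u := by
  set s : ℂ := 1 / 2 + Complex.I * u with hs
  have hcs : conj s = 1 - s := by
    apply Complex.ext <;> simp [hs]
    norm_num
  have hs0 : s ≠ 0 := by
    intro h
    have := congrArg Complex.re h
    simp [hs] at this
  have hπ : (Real.pi : ℂ) ≠ 0 := by exact_mod_cast Real.pi_ne_zero
  have hΛ : ∀ z : ℂ, z ≠ 0 → Complex.Gammaℝ z ≠ 0 →
      completedRiemannZeta z = Complex.Gammaℝ z * riemannZeta z := by
    intro z hz hg
    rw [riemannZeta_def_of_ne_zero hz]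
    field_simp
  have hGs : Complex.Gammaℝ s ≠ 0 := Complex.Gammaℝ_ne_zero_of_re_pos (by simp [hs])
  have hGconj : Complex.Gammaℝ (conj s) = conj (Complex.Gammaℝ s) := by
    rw [Complex.Gammaℝ_def, Complex.Gammaℝ_def, map_mul, ← Complex.Gamma_conj]
    congr 1
    · rw [Complex.cpow_def_of_ne_zero hπ, Complex.cpow_def_of_ne_zero hπ, ← Complex.exp_conj,
        map_mul, ← Complex.ofReal_log Real.pi_pos.le, Complex.conj_ofReal]
      simp [map_ofNat (starRingEnd ℂ) 2]
    · simp [map_ofNat (starRingEnd ℂ) 2]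
  have hreal : conj (completedRiemannZeta s) = completedRiemannZeta s := by
    have h1 : completedRiemannZeta (conj s) = conj (completedRiemannZeta s) := by
      rw [hΛ _ hs0 hGs, hΛ (conj s) (by simpa using hs0) (by rw [hGconj]; simpa using hGs),
        map_mul, hGconj, riemannZeta_conj]
    rw [← h1, hcs, completedRiemannZeta_one_sub]
  have hZ : hardyZ u = (Real.pi : ℂ) ^ (1 / 4 : ℂ) * completedRiemannZeta s /
      (‖Complex.Gamma (1 / 4 + Complex.I * u / 2)‖ : ℂ) := by
    rw [hΛ s hs0 hGs, Complex.Gammaℝ_def, hardyZ, ← mul_assoc, ← mul_assoc,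
      ← Complex.cpow_add _ _ hπ]
    congr 3
    · congr 1
      rw [hs]; ring
    · congr 1
      rw [hs]; ring
  have hπr : conj ((Real.pi : ℂ) ^ (1 / 4 : ℂ)) = (Real.pi : ℂ) ^ (1 / 4 : ℂ) := by
    have : (Real.pi : ℂ) ^ (1 / 4 : ℂ) = ((Real.pi ^ (1 / 4 : ℝ) : ℝ) : ℂ) := by
      rw [Complex.ofReal_cpow Real.pi_pos.le]; norm_num
    rw [this, Complex.conj_ofReal]
  rw [hZ, map_div₀, map_mul, hπr, hreal, Complex.conj_ofReal]

/-- Holomorphic continuation of `hardyZ` to discs `|s - t| < t`, with polynomial growth in any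
strip `-2M ≤ im s ≤ 0`. With `l` a branch of `log Γ(1/4 + is/2)`, the phase
`π^{-is/2} Γ(1/4 + is/2) / |Γ(1/4 + is/2)|` continues to
`exp ((l(s) - conj (l (conj s))) / 2 - i s log π / 2)`. -/
lemma exists_hardyZ_continuation (M : ℕ) :
    ∃ C : ℝ, 0 ≤ C ∧ ∀ t : ℝ, 0 < t → ∃ F : ℂ → ℂ,
      DifferentiableOn ℂ F (Metric.ball (t : ℂ) t) ∧
      (∀ u : ℝ, (u : ℂ) ∈ Metric.ball (t : ℂ) t → F u = hardyZ u) ∧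
      ∀ s ∈ Metric.ball (t : ℂ) t, 1 ≤ s.re → -(2 * M) ≤ s.im → s.im ≤ 0 →
        ‖F s‖ ≤ C * (1 + ‖s‖) ^ (M + 2) := by
  obtain ⟨C, hC0, hC⟩ := exists_norm_Gamma_le_norm_Gamma_reflected M
  refine ⟨4 * Real.sqrt C * (M + 1) ^ (M + 1), by positivity, fun t ht => ?_⟩
  set B := Metric.ball (t : ℂ) t with hB
  have hBre : ∀ s ∈ B, 0 < s.re := by
    intro s hs
    have h1 : |(s - t).re| < t :=
      (Complex.abs_re_le_norm _).trans_lt (by rwa [hB, mem_ball_iff_norm] at hs)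
    rw [Complex.sub_re, Complex.ofReal_re] at h1
    linarith [(abs_lt.1 h1).1]
  have hBconj : ∀ s ∈ B, conj s ∈ B := by
    intro s hs
    rw [hB, mem_ball_iff_norm] at hs ⊢
    rwa [← Complex.conj_ofReal, ← map_sub, RCLike.norm_conj]
  set g : ℂ → ℂ := fun s => Complex.Gamma (1 / 4 + Complex.I * s / 2) with hg
  have hgd : DifferentiableOn ℂ g B := fun s hs =>
    (DifferentiableAt.comp (f := fun s : ℂ => 1 / 4 + Complex.I * s / 2) s
      (Complex.differentiableAt_Gamma _ (quarter_add_ne_neg_nat_of_re_pos (hBre s hs)))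
      (by fun_prop)).differentiableWithinAt
  have hg0 : ∀ s ∈ B, g s ≠ 0 := fun s hs =>
    Complex.Gamma_ne_zero (quarter_add_ne_neg_nat_of_re_pos (hBre s hs))
  obtain ⟨l, hld, hl⟩ := exists_holomorphic_log_on_ball ht hgd hg0
  set p : ℂ → ℂ := fun s => (l s - conj (l (conj s))) / 2 - Complex.I * s * Real.log Real.pi / 2
    with hp
  have hpd : DifferentiableOn ℂ p B := by
    intro s hs
    have h1 : DifferentiableAt ℂ l s := hld.differentiableAt (Metric.isOpen_ball.mem_nhds hs)
    have h2 : DifferentiableAt ℂ (fun z => conj (l (conj z))) s :=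
      differentiableAt_conj_conj_iff.2
        (hld.differentiableAt (Metric.isOpen_ball.mem_nhds (hBconj s hs)))
    exact (((h1.sub h2).div_const 2).sub (by fun_prop)).differentiableWithinAt
  have hζ1 : ∀ s ∈ B, 1 / 2 + Complex.I * s ≠ 1 := by
    intro s hs h
    have := congrArg Complex.im h
    simp at this
    exact (hBre s hs).ne' this
  refine ⟨fun s => Complex.exp (p s) * riemannZeta (1 / 2 + Complex.I * s), ?_, ?_, ?_⟩
  · refine hpd.cexp.mul fun s hs => ?_
    exact (DifferentiableAt.comp (f := fun s : ℂ => 1 / 2 + Complex.I * s) s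
      (differentiableAt_riemannZeta (hζ1 s hs)) (by fun_prop)).differentiableWithinAt
  · intro u hu
    have hπ : (Real.pi : ℂ) ≠ 0 := by exact_mod_cast Real.pi_ne_zero
    have e1 : Complex.exp (p u) = (Real.pi : ℂ) ^ (-(Complex.I * u / 2)) * g u /
        (‖g u‖ : ℂ) := by
      rw [← hl u hu, Complex.norm_exp, Complex.cpow_def_of_ne_zero hπ, Complex.ofReal_exp,
        ← Complex.exp_add, ← Complex.exp_sub]
      congr 1
      simp only [hp, Complex.conj_ofReal]
      rw [← Complex.ofReal_log Real.pi_pos.le]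
      have : ((l u).re : ℂ) = (l u + conj (l u)) / 2 := Complex.re_eq_add_conj _
      rw [this]
      ring
    change Complex.exp (p u) * _ = _
    rw [e1, hardyZ]
    ring
  · intro s hs h1 h2 h3
    have hs' := hBconj s hs
    set h : ℝ := -s.im / 2 with hh
    have eg : g s = Complex.Gamma ((1 / 4 + h : ℝ) + (s.re / 2 : ℝ) * Complex.I) := by
      simp only [hg]
      congr 1
      apply Complex.ext <;> simp [hh]
    have eg' : g (conj s) = Complex.Gamma ((1 / 4 - h : ℝ) + (s.re / 2 : ℝ) * Complex.I) := by
      simp only [hg]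
      congr 1
      apply Complex.ext <;> simp [hh]
      ring
    -- `s` and `conj s` give Gamma arguments with real parts `1/4 + h` and `1/4 - h`.
    have hΓ := hC h (by rw [hh]; linarith) (by rw [hh]; linarith) (s.re / 2) (by linarith)
    rw [← eg, ← eg', ← hl s hs, ← hl _ hs', Complex.norm_exp, Complex.norm_exp] at hΓ
    have hn1 : |s.re / 2| ≤ ‖s‖ := by
      rw [abs_div, abs_two]
      have := Complex.abs_re_le_norm s
      linarith [abs_nonneg s.re]
    have hexp : ‖Complex.exp (p s)‖ ^ 2 ≤
        (Real.sqrt C * ((M + 1) * (1 + ‖s‖)) ^ (M + 1)) ^ 2 := by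
      have hre : 2 * (p s).re = (l s).re - (l (conj s)).re + s.im * Real.log Real.pi := by
        simp [hp]
        ring
      rw [Complex.norm_exp, ← Real.exp_nat_mul, Nat.cast_ofNat, hre]
      have hlog : s.im * Real.log Real.pi ≤ 0 :=
        mul_nonpos_of_nonpos_of_nonneg h3
          (Real.log_nonneg (by linarith [Real.pi_gt_three]))
      calc _ ≤ Real.exp ((l s).re - (l (conj s)).re) := by
            apply Real.exp_le_exp.2; linarith
        _ ≤ C * (M + 1 + |s.re / 2|) ^ (2 * (M + 1)) := by
            rw [Real.exp_sub, div_le_iff₀ (Real.exp_pos _)]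
            exact hΓ
        _ ≤ C * ((M + 1) * (1 + ‖s‖)) ^ (2 * (M + 1)) := by
            gcongr
            nlinarith [norm_nonneg s, (Nat.cast_nonneg M : (0 : ℝ) ≤ M)]
        _ = _ := by
            rw [mul_pow (Real.sqrt C), Real.sq_sqrt hC0, ← pow_mul, mul_comm 2 (M + 1)]
    have hE : ‖Complex.exp (p s)‖ ≤ Real.sqrt C * ((M + 1) * (1 + ‖s‖)) ^ (M + 1) :=
      le_of_sq_le_sq hexp (by positivity)
    have hZ : ‖riemannZeta (1 / 2 + Complex.I * s)‖ ≤ 4 * (1 + ‖s‖) := by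
      refine (norm_riemannZeta_le _ (by simp; linarith) ?_).trans ?_
      · refine le_trans ?_ (Complex.abs_im_le_norm _)
        simp
        linarith [le_abs_self s.re]
      · gcongr
        refine (norm_add_le _ _).trans ?_
        simp only [norm_mul, Complex.norm_I, one_mul]
        norm_num
    rw [norm_mul]
    calc _ ≤ (Real.sqrt C * ((M + 1) * (1 + ‖s‖)) ^ (M + 1)) * (4 * (1 + ‖s‖)) := by gcongr
      _ = _ := by rw [mul_pow]; ring

/-! ### Fourier–Laplace transforms of test functions -/

/-- The Fourier–Laplace transform `w ↦ ∫ g(u) e^{-2πiwu} du` at complex frequencies `w`. -/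
noncomputable def fourierLaplace (g : ℝ → ℝ) (w : ℂ) : ℂ :=
  ∫ u : ℝ, (g u : ℂ) * Complex.exp (-(2 * Real.pi * Complex.I * w * u))

lemma norm_exp_neg_two_pi_I_mul (w : ℂ) (u : ℝ) :
    ‖Complex.exp (-(2 * Real.pi * Complex.I * w * u))‖ = Real.exp (2 * Real.pi * w.im * u) := by
  rw [Complex.norm_exp]
  congr 1
  simp

lemma norm_mul_exp_le {g : ℝ → ℝ} {a : ℝ} (hs : tsupport g ⊆ Set.Icc (-a) a) (w : ℂ) (u : ℝ) :
    ‖(g u : ℂ) * Complex.exp (-(2 * Real.pi * Complex.I * w * u))‖ ≤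
      ‖g u‖ * Real.exp (2 * Real.pi * a * |w.im|) := by
  rw [norm_mul, Complex.norm_real, norm_exp_neg_two_pi_I_mul]
  by_cases hu : u ∈ Set.Icc (-a) a
  · gcongr ?_ * ?_
    apply Real.exp_le_exp.2
    have h1 : w.im * u ≤ |w.im| * a := by
      refine (le_abs_self _).trans ?_
      rw [abs_mul]
      exact mul_le_mul_of_nonneg_left (abs_le.2 hu) (abs_nonneg _)
    nlinarith [Real.pi_pos]
  · have : g u = 0 := image_eq_zero_of_notMem_tsupport fun h => hu (hs h)
    simp [this]

lemma hasCompactSupport_of_tsupport_subset_Icc {g : ℝ → ℝ} {a : ℝ}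
    (hs : tsupport g ⊆ Set.Icc (-a) a) : HasCompactSupport g :=
  isCompact_Icc.of_isClosed_subset (isClosed_tsupport g) hs

lemma integrable_mul_exp {g : ℝ → ℝ} {a : ℝ} (hg : Continuous g)
    (hs : tsupport g ⊆ Set.Icc (-a) a) (w : ℂ) :
    Integrable fun u : ℝ =>
      (g u : ℂ) * Complex.exp (-(2 * Real.pi * Complex.I * w * u)) :=
  ((hg.integrable_of_hasCompactSupport
    (hasCompactSupport_of_tsupport_subset_Icc hs)).norm.mul_const _).mono'
    (by fun_prop) (Filter.Eventually.of_forall (norm_mul_exp_le hs w))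

lemma norm_fourierLaplace_le {g : ℝ → ℝ} {a : ℝ} (hg : Continuous g)
    (hs : tsupport g ⊆ Set.Icc (-a) a) (w : ℂ) :
    ‖fourierLaplace g w‖ ≤ (∫ u, ‖g u‖) * Real.exp (2 * Real.pi * a * |w.im|) := by
  rw [← integral_mul_const]
  exact norm_integral_le_of_norm_le
    ((hg.integrable_of_hasCompactSupport
      (hasCompactSupport_of_tsupport_subset_Icc hs)).norm.mul_const _)
    (Filter.Eventually.of_forall (norm_mul_exp_le hs w))

lemma differentiable_fourierLaplace {g : ℝ → ℝ} {a : ℝ} (hg : Continuous g)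
    (hs : tsupport g ⊆ Set.Icc (-a) a) : Differentiable ℂ (fourierLaplace g) := by
  intro w₀
  have hgi := hg.integrable_of_hasCompactSupport (μ := volume) (hasCompactSupport_of_tsupport_subset_Icc hs)
  refine (hasDerivAt_integral_of_dominated_loc_of_deriv_le (μ := volume) (𝕜 := ℂ)
    (F := fun w (u : ℝ) => (g u : ℂ) * Complex.exp (-(2 * Real.pi * Complex.I * w * u)))
    (F' := fun w (u : ℝ) => -(2 * Real.pi * Complex.I * u) *
      ((g u : ℂ) * Complex.exp (-(2 * Real.pi * Complex.I * w * u))))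
    (bound := fun u => 2 * Real.pi * |a| *
      (‖g u‖ * Real.exp (2 * Real.pi * |a| * (|w₀.im| + 1))))
    (Metric.ball_mem_nhds w₀ one_pos)
    (Filter.Eventually.of_forall fun w => (integrable_mul_exp hg hs w).aestronglyMeasurable)
    (integrable_mul_exp hg hs w₀) (by fun_prop) ?_ ?_ ?_).2.differentiableAt
  · refine Filter.Eventually.of_forall fun u w hw => ?_
    have hw' : |w.im| ≤ |w₀.im| + 1 := by
      have h1 : |(w - w₀).im| < 1 :=
        (Complex.abs_im_le_norm _).trans_lt (by rwa [mem_ball_iff_norm] at hw)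
      rw [Complex.sub_im] at h1
      have := abs_sub_abs_le_abs_sub w.im w₀.im
      linarith
    by_cases hu : u ∈ Set.Icc (-a) a
    · have hua : |u| ≤ |a| := (abs_le.2 hu).trans (le_abs_self a)
      rw [norm_mul]
      refine mul_le_mul ?_ ((norm_mul_exp_le hs w u).trans ?_) (norm_nonneg _)
        (by have := Real.pi_pos; positivity)
      · rw [norm_neg, norm_mul, norm_mul, norm_mul, Complex.norm_real, Complex.norm_real,
          Complex.norm_I, Complex.norm_two, Real.norm_of_nonneg Real.pi_pos.le, mul_one,
          Real.norm_eq_abs]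
        have := Real.pi_pos
        gcongr
      · have := Real.pi_pos
        gcongr
        exact le_abs_self a
    · have : g u = 0 := image_eq_zero_of_notMem_tsupport fun h => hu (hs h)
      simp [this]
  · exact (hgi.norm.mul_const _).const_mul _
  · refine Filter.Eventually.of_forall fun u w _ => ?_
    have h1 : HasDerivAt (fun w : ℂ => -(2 * Real.pi * Complex.I * w * u))
        (-(2 * Real.pi * Complex.I * u)) w := by
      have := (((hasDerivAt_id w).const_mul (2 * Real.pi * Complex.I)).mul_const (u : ℂ)).fun_neg
      simpa using this
    refine (h1.cexp.const_mul (g u : ℂ)).congr_deriv ?_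
    ring

lemma fourierLaplace_deriv {g : ℝ → ℝ} {a : ℝ} (hg : ContDiff ℝ 1 g)
    (hs : tsupport g ⊆ Set.Icc (-a) a) (w : ℂ) :
    fourierLaplace (deriv g) w = 2 * Real.pi * Complex.I * w * fourierLaplace g w := by
  have hg' : Continuous (deriv g) := hg.continuous_deriv le_rfl
  have hs' : tsupport (deriv g) ⊆ Set.Icc (-a) a :=
    (closure_minimal (support_deriv_subset) (isClosed_tsupport g)).trans hs
  have hexp : ∀ u : ℝ, HasDerivAt
      (fun u : ℝ => Complex.exp (-(2 * Real.pi * Complex.I * w * u)))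
      (-(2 * Real.pi * Complex.I * w) *
        Complex.exp (-(2 * Real.pi * Complex.I * w * u))) u := by
    intro u
    have h1 : HasDerivAt (fun u : ℝ => -(2 * Real.pi * Complex.I * w * u))
        (-(2 * Real.pi * Complex.I * w)) u := by
      simpa using ((Complex.ofRealCLM.hasDerivAt (x := u)).const_mul
        (2 * Real.pi * Complex.I * w)).fun_neg
    refine h1.cexp.congr_deriv ?_
    ring
  have hgd : ∀ u : ℝ, HasDerivAt (fun u : ℝ => (g u : ℂ)) ((deriv g u : ℝ) : ℂ) u := fun u =>
    ((hg.differentiable one_ne_zero) u).hasDerivAt.ofReal_comp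
  have e1 := integral_mul_deriv_eq_deriv_mul_of_integrable
    (u := fun u : ℝ => Complex.exp (-(2 * Real.pi * Complex.I * w * u)))
    (v := fun u : ℝ => (g u : ℂ))
    (u' := fun u : ℝ => -(2 * Real.pi * Complex.I * w) *
        Complex.exp (-(2 * Real.pi * Complex.I * w * u)))
    (v' := fun u : ℝ => ((deriv g u : ℝ) : ℂ))
    (fun u _ => hexp u) (fun u _ => hgd u)
    ((integrable_mul_exp hg' hs' w).congr (Filter.Eventually.of_forall fun u => by
      simp only [Pi.mul_apply]; ring))
    (((integrable_mul_exp hg.continuous hs w).const_mul (-(2 * Real.pi * Complex.I * w))).congr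
      (Filter.Eventually.of_forall fun u => by simp only [Pi.mul_apply]; ring))
    ((integrable_mul_exp hg.continuous hs w).congr (Filter.Eventually.of_forall fun u => by
      simp only [Pi.mul_apply]; ring))
  rw [fourierLaplace, fourierLaplace, ← integral_const_mul]
  calc _ = ∫ u : ℝ, Complex.exp (-(2 * Real.pi * Complex.I * w * u)) * ((deriv g u : ℝ) : ℂ) :=
        integral_congr_ae (Filter.Eventually.of_forall fun u => mul_comm _ _)
    _ = _ := by
        rw [e1, ← integral_neg]
        exact integral_congr_ae (Filter.Eventually.of_forall fun u => by ring)

/-- Repeated integration by parts: the transform of a smooth function supported in `[-a, a]` decays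
faster than any power, uniformly up to the exponential factor `e^{2πa|im w|}`. -/
lemma exists_pow_mul_norm_fourierLaplace_le {a : ℝ} (k : ℕ) : ∀ {g : ℝ → ℝ}, ContDiff ℝ ∞ g →
    tsupport g ⊆ Set.Icc (-a) a → ∃ C : ℝ, 0 ≤ C ∧ ∀ w : ℂ,
      ‖w‖ ^ k * ‖fourierLaplace g w‖ ≤ C * Real.exp (2 * Real.pi * a * |w.im|) := by
  induction k with
  | zero =>
    intro g hg hs
    exact ⟨∫ u, ‖g u‖, integral_nonneg fun _ => norm_nonneg _, fun w => by
      simpa using norm_fourierLaplace_le hg.continuous hs w⟩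
  | succ k ih =>
    intro g hg hs
    have hs' : tsupport (deriv g) ⊆ Set.Icc (-a) a :=
      (closure_minimal (support_deriv_subset) (isClosed_tsupport g)).trans hs
    obtain ⟨C, hC, h⟩ := ih (contDiff_infty_iff_deriv.1 hg).2 hs'
    refine ⟨C, hC, fun w => le_trans ?_ (h w)⟩
    rw [fourierLaplace_deriv (hg.of_le (by exact_mod_cast le_top)) hs, norm_mul, norm_mul, norm_mul,
      norm_mul, Complex.norm_I, Complex.norm_real, Complex.norm_two,
      Real.norm_of_nonneg Real.pi_pos.le, pow_succ]
    have h1 : 1 ≤ 2 * Real.pi := by linarith [Real.pi_gt_three]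
    have h2 : 0 ≤ ‖w‖ ^ k * ‖w‖ * ‖fourierLaplace g w‖ := by positivity
    nlinarith

lemma fourierLaplace_comp_add (g : ℝ → ℝ) (c : ℝ) (w : ℂ) :
    fourierLaplace (fun u => g (u + c)) w =
      Complex.exp (2 * Real.pi * Complex.I * w * c) * fourierLaplace g w := by
  rw [fourierLaplace, fourierLaplace, ← integral_const_mul,
    ← integral_add_right_eq_self (μ := volume) (fun u : ℝ =>
      Complex.exp (2 * Real.pi * Complex.I * w * c) *
        ((g u : ℂ) * Complex.exp (-(2 * Real.pi * Complex.I * w * u)))) c]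
  refine integral_congr_ae (Filter.Eventually.of_forall fun u => ?_)
  simp only
  rw [mul_left_comm, ← Complex.exp_add]
  congr 2
  push_cast
  ring

lemma conj_fourierLaplace_of_even {g : ℝ → ℝ} (he : ∀ x, g (-x) = g x) (x : ℝ) :
    conj (fourierLaplace g x) = fourierLaplace g x := by
  rw [fourierLaplace, ← integral_conj, ← integral_neg_eq_self]
  refine integral_congr_ae (Filter.Eventually.of_forall fun u => ?_)
  simp only [map_mul, Complex.conj_ofReal, ← Complex.exp_conj, he]
  congr 2
  simp [map_ofNat]

/-! ### The plateau function and its Fourier transform -/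

section Plateau

variable {φ : ℝ → ℝ} {a b : ℝ}

lemma tsupport_subset_Icc_of_eq_zero (hs : ∀ x, a ≤ |x| → φ x = 0) :
    tsupport φ ⊆ Set.Icc (-a) a := by
  refine closure_minimal (fun y hy => ?_) isClosed_Icc
  by_contra h
  exact hy (hs y (le_of_lt (not_le.1 fun h' => h (abs_le.1 h'))))

lemma hasDerivAt_plateau (hφ : Continuous φ) (b x : ℝ) :
    HasDerivAt (plateau φ b) (φ (x + b) - φ (x - b)) x := by
  have hF : ∀ y, HasDerivAt (fun y => ∫ t in (0 : ℝ)..y, φ t) (φ y) y := fun y =>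
    intervalIntegral.integral_hasDerivAt_right (hφ.intervalIntegrable _ _)
      (hφ.stronglyMeasurableAtFilter _ _) hφ.continuousAt
  have e : plateau φ b = fun x => (∫ t in (0 : ℝ)..(x + b), φ t) - ∫ t in (0 : ℝ)..(x - b), φ t := by
    funext y
    rw [plateau, intervalIntegral.integral_interval_sub_left] <;>
      exact hφ.intervalIntegrable _ _
  rw [e]
  exact ((hF (x + b)).comp_add_const x b).sub ((hF (x - b)).comp_sub_const x b)

lemma contDiff_plateau (hφ : ContDiff ℝ ∞ φ) (b : ℝ) : ContDiff ℝ ∞ (plateau φ b) := by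
  rw [contDiff_infty_iff_deriv]
  refine ⟨fun x => (hasDerivAt_plateau hφ.continuous b x).differentiableAt, ?_⟩
  rw [show deriv (plateau φ b) = fun x => φ (x + b) - φ (x - b) from
    funext fun x => (hasDerivAt_plateau hφ.continuous b x).deriv]
  exact (hφ.comp (contDiff_id.add contDiff_const)).sub (hφ.comp (contDiff_id.sub contDiff_const))

lemma tsupport_plateau_subset (hs : ∀ x, a ≤ |x| → φ x = 0) (hb : 0 < b) :
    tsupport (plateau φ b) ⊆ Set.Icc (-(a + b)) (a + b) := by
  refine closure_minimal (fun x hx => ?_) isClosed_Icc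
  by_contra hxI
  apply hx
  rw [plateau]
  refine (intervalIntegral.integral_congr (g := fun _ => (0 : ℝ)) fun t ht => ?_).trans (by simp)
  rw [Set.uIcc_of_le (by linarith)] at ht
  refine hs t ?_
  rw [Set.mem_Icc, not_and_or, not_le, not_le] at hxI
  rcases hxI with h | h
  · exact le_trans (by linarith [ht.2]) (neg_le_abs t)
  · exact le_trans (by linarith [ht.1]) (le_abs_self t)

lemma plateau_zero (hs : ∀ x, a ≤ |x| → φ x = 0) (hab : a < b) :
    plateau φ b 0 = ∫ x, φ x := by
  rw [plateau, intervalIntegral.integral_eq_integral_of_support_subset]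
  intro x hx
  have : |x| < a := by
    by_contra h
    exact hx (hs x (not_lt.1 h))
  rw [abs_lt] at this
  constructor <;> linarith [this.1, this.2]

lemma plateauFourier_eq_fourierLaplace (φ : ℝ → ℝ) (b x : ℝ) :
    plateauFourier φ b x = fourierLaplace (plateau φ b) x := by
  rw [plateauFourier, Real.fourier_real_eq_integral_exp_smul, fourierLaplace]
  refine integral_congr_ae (Filter.Eventually.of_forall fun u => ?_)
  simp only [smul_eq_mul]
  rw [mul_comm]
  congr 2
  push_cast
  ring

/-- `Φ' = φ(· + b) - φ(· - b)` gives `f(x) = φ̂(x) sin(2πbx) / (πx)`. -/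
lemma mul_plateauFourier (hφ : ContDiff ℝ ∞ φ) (hs : ∀ x, a ≤ |x| → φ x = 0) (hb : 0 < b)
    (x : ℝ) :
    2 * Real.pi * Complex.I * x * plateauFourier φ b x =
      (Complex.exp (2 * Real.pi * Complex.I * x * b) -
        Complex.exp (-(2 * Real.pi * Complex.I * x * b))) * fourierLaplace φ x := by
  have hts := tsupport_subset_Icc_of_eq_zero hs
  rw [plateauFourier_eq_fourierLaplace, ← fourierLaplace_deriv
    ((contDiff_plateau hφ b).of_le (by exact_mod_cast le_top)) (tsupport_plateau_subset hs hb),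
    show deriv (plateau φ b) = fun x => φ (x + b) - φ (x - b) from
    funext fun x => (hasDerivAt_plateau hφ.continuous b x).deriv]
  have hi : ∀ c : ℝ, Integrable fun u : ℝ => ((φ (u + c) : ℝ) : ℂ) *
      Complex.exp (-(2 * Real.pi * Complex.I * x * u)) := by
    intro c
    refine (((integrable_mul_exp hφ.continuous hts x).comp_add_right c).const_mul
      (Complex.exp (2 * Real.pi * Complex.I * x * c))).congr
      (Filter.Eventually.of_forall fun u => ?_)
    simp only
    rw [mul_left_comm, ← Complex.exp_add]
    congr 2
    push_cast
    ring
  have e1 : fourierLaplace (fun u => φ (u + b) - φ (u - b)) x =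
      fourierLaplace (fun u => φ (u + b)) x - fourierLaplace (fun u => φ (u + -b)) x := by
    rw [fourierLaplace, fourierLaplace, fourierLaplace, ← integral_sub (hi b) (hi (-b))]
    refine integral_congr_ae (Filter.Eventually.of_forall fun u => ?_)
    simp only [← sub_eq_add_neg]
    push_cast
    ring
  rw [e1, fourierLaplace_comp_add, fourierLaplace_comp_add]
  push_cast
  rw [mul_neg, sub_mul]

lemma exists_abs_pow_mul_norm_plateauFourier_le (hφ : ContDiff ℝ ∞ φ)
    (hs : ∀ x, a ≤ |x| → φ x = 0) (hb : 0 < b) (k : ℕ) :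
    ∃ C : ℝ, 0 ≤ C ∧ ∀ x : ℝ, |x| ^ k * ‖plateauFourier φ b x‖ ≤ C := by
  obtain ⟨C, hC, h⟩ := exists_pow_mul_norm_fourierLaplace_le k (contDiff_plateau hφ b)
    (tsupport_plateau_subset hs hb)
  refine ⟨C, hC, fun x => ?_⟩
  have := h x
  rw [plateauFourier_eq_fourierLaplace]
  simpa using this

lemma continuous_plateauFourier (hφ : ContDiff ℝ ∞ φ)
    (hs : ∀ x, a ≤ |x| → φ x = 0) (hb : 0 < b) : Continuous (plateauFourier φ b) := by
  rw [show plateauFourier φ b = fun x : ℝ => fourierLaplace (plateau φ b) x from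
    funext (plateauFourier_eq_fourierLaplace φ b)]
  exact (differentiable_fourierLaplace (contDiff_plateau hφ b).continuous
    (tsupport_plateau_subset hs hb)).continuous.comp Complex.continuous_ofReal

lemma integrable_abs_pow_mul_plateauFourier (hφ : ContDiff ℝ ∞ φ)
    (hs : ∀ x, a ≤ |x| → φ x = 0) (hb : 0 < b) (k : ℕ) :
    Integrable fun x : ℝ => |x| ^ k * ‖plateauFourier φ b x‖ := by
  obtain ⟨C, hC, h⟩ := exists_abs_pow_mul_norm_plateauFourier_le hφ hs hb k
  obtain ⟨D, hD, h'⟩ := exists_abs_pow_mul_norm_plateauFourier_le hφ hs hb (k + 2)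
  have hc := continuous_plateauFourier hφ hs hb
  refine (integrable_inv_one_add_sq.const_mul (C + D)).mono' (by fun_prop)
    (Filter.Eventually.of_forall fun x => ?_)
  rw [Real.norm_of_nonneg (by positivity), ← div_eq_mul_inv, le_div_iff₀ (by positivity)]
  have h1 := h x
  have h2 := h' x
  rw [pow_add, sq_abs] at h2
  linarith

lemma integral_plateauFourier (hφ : ContDiff ℝ ∞ φ)
    (hs : ∀ x, a ≤ |x| → φ x = 0) (ha : 0 < a) (hab : a < b) :
    ∫ x, plateauFourier φ b x = ((∫ x, φ x : ℝ) : ℂ) := by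
  have hb : 0 < b := ha.trans hab
  have hΦ : Continuous (fun u : ℝ => (plateau φ b u : ℂ)) :=
    Complex.continuous_ofReal.comp (contDiff_plateau hφ b).continuous
  have hΦi : Integrable (fun u : ℝ => (plateau φ b u : ℂ)) :=
    ((contDiff_plateau hφ b).continuous.integrable_of_hasCompactSupport
      (hasCompactSupport_of_tsupport_subset_Icc (tsupport_plateau_subset hs hb))).ofReal
  have hfi : Integrable (𝓕 (fun u : ℝ => (plateau φ b u : ℂ))) := by
    have h0 := integrable_abs_pow_mul_plateauFourier hφ hs hb 0
    simp only [pow_zero, one_mul] at h0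
    exact (integrable_norm_iff
      (continuous_plateauFourier hφ hs hb).aestronglyMeasurable).1 h0
  have h := congrFun (hΦ.fourierInv_fourier_eq hΦi hfi) 0
  rw [Real.fourierInv_eq'] at h
  simp only [inner_zero_right, mul_zero, Complex.ofReal_zero, zero_mul, Complex.exp_zero,
    one_smul] at h
  rw [← plateau_zero hs hab]
  exact h

end Plateau

/-! ### Shifting the contour -/

/-- Cauchy's theorem used to push the segment `[-X, X]` down to height `-Y`. -/
lemma norm_integral_le_of_shift_down {P : ℂ → ℂ} {X Y B₁ B₂ : ℝ} (hX : 0 ≤ X) (hY : 0 ≤ Y)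
    (hP : DifferentiableOn ℂ P (Set.uIcc (-X) X ×ℂ Set.uIcc 0 (-Y)))
    (hB₁ : ∀ x : ℝ, |x| ≤ X → ‖P (x + (-Y : ℝ) * Complex.I)‖ ≤ B₁)
    (hB₂ : ∀ x y : ℝ, |x| = X → -Y ≤ y → y ≤ 0 → ‖P (x + y * Complex.I)‖ ≤ B₂) :
    ‖∫ x : ℝ in (-X)..X, P x‖ ≤ 2 * X * B₁ + 2 * Y * B₂ := by
  have h := Complex.integral_boundary_rect_eq_zero_of_differentiableOn P (-X : ℝ)
    ((X : ℝ) + (-Y : ℝ) * Complex.I) (by simpa using hP)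
  have e1 : (((X : ℝ) : ℂ) + (-Y : ℝ) * Complex.I).re = X := by simp
  have e2 : (((X : ℝ) : ℂ) + (-Y : ℝ) * Complex.I).im = -Y := by simp
  rw [e1, e2, Complex.ofReal_re, Complex.ofReal_im] at h
  simp only [Complex.ofReal_zero, zero_mul, add_zero] at h
  have b1 : ‖∫ x : ℝ in (-X)..X, P (x + (-Y : ℝ) * Complex.I)‖ ≤ B₁ * |X - -X| :=
    intervalIntegral.norm_integral_le_of_norm_le_const fun x hx => by
      rw [Set.uIoc_of_le (by linarith)] at hx
      exact hB₁ x (abs_le.2 ⟨hx.1.le, hx.2⟩)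
  have b2 : ∀ x : ℝ, |x| = X →
      ‖∫ y : ℝ in (0 : ℝ)..(-Y), P (x + y * Complex.I)‖ ≤ B₂ * |-Y - 0| := fun x hx =>
    intervalIntegral.norm_integral_le_of_norm_le_const fun y hy => by
      rw [Set.uIoc_of_ge (by linarith)] at hy
      exact hB₂ x y hx hy.1.le hy.2
  have b3 := b2 X (abs_of_nonneg hX)
  have b4 := b2 (-X) (by rw [abs_neg, abs_of_nonneg hX])
  rw [sub_neg_eq_add, abs_of_nonneg (by linarith)] at b1
  rw [sub_zero, abs_neg, abs_of_nonneg hY] at b3 b4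
  have e : ∫ x : ℝ in (-X)..X, P x = (∫ x : ℝ in (-X)..X, P (x + (-Y : ℝ) * Complex.I)) -
      Complex.I * (∫ y : ℝ in (0 : ℝ)..(-Y), P ((X : ℝ) + y * Complex.I)) +
      Complex.I * (∫ y : ℝ in (0 : ℝ)..(-Y), P ((-X : ℝ) + y * Complex.I)) := by
    simp only [smul_eq_mul] at h
    linear_combination h
  rw [e]
  refine (norm_add_le _ _).trans ?_
  refine (add_le_add_left (norm_sub_le _ _) _).trans ?_
  rw [norm_mul, norm_mul, Complex.norm_I, one_mul, one_mul]
  linarith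

section Convolution

variable {φ : ℝ → ℝ} {a b : ℝ}

lemma integrable_hardyZ_mul_plateauFourier (hφ : ContDiff ℝ ∞ φ)
    (hs : ∀ x, a ≤ |x| → φ x = 0) (hb : 0 < b) {G : ℝ} (hG : 0 < G) (t : ℝ) :
    Integrable fun x : ℝ => hardyZ (t + x) * plateauFourier φ b (x / G) := by
  have h0 := (integrable_abs_pow_mul_plateauFourier hφ hs hb 0).comp_div hG.ne'
  have h1 := (integrable_abs_pow_mul_plateauFourier hφ hs hb 1).comp_div hG.ne'
  have hc := continuous_plateauFourier hφ hs hb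
  have hZ := continuous_hardyZ
  refine ((h0.const_mul (4 * (1 + |t|))).add (h1.const_mul (4 * G))).mono'
    (by fun_prop) (Filter.Eventually.of_forall fun x => ?_)
  simp only [Pi.add_apply, pow_zero, pow_one, one_mul]
  have hx : G * |x / G| = |x| := by
    rw [abs_div, abs_of_pos hG]; field_simp
  rw [norm_mul]
  calc _ ≤ (4 * (1 + |t + x|)) * ‖plateauFourier φ b (x / G)‖ := by
        gcongr; exact norm_hardyZ_le _
    _ ≤ (4 * (1 + (|t| + |x|))) * ‖plateauFourier φ b (x / G)‖ := by
        gcongr; exact abs_add_le _ _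
    _ = _ := by rw [← hx]; ring

lemma integrable_const_mul_plateauFourier (hφ : ContDiff ℝ ∞ φ)
    (hs : ∀ x, a ≤ |x| → φ x = 0) (hb : 0 < b) {G : ℝ} (hG : 0 < G) (c : ℂ) :
    Integrable fun x : ℝ => c * plateauFourier φ b (x / G) := by
  have h0 := integrable_abs_pow_mul_plateauFourier hφ hs hb 0
  simp only [pow_zero, one_mul] at h0
  exact ((((integrable_norm_iff
    (continuous_plateauFourier hφ hs hb).aestronglyMeasurable).1 h0)).comp_div hG.ne').const_mul c

/-- As `∫ f(x/G) dx = G Φ(0) = G`, the quantity to be estimated is the convolution of `f` with the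
increment of `Z`, whose quotient by `x` has no pole at `0`. -/
lemma convZ_sub_eq (hφ : ContDiff ℝ ∞ φ) (hs : ∀ x, a ≤ |x| → φ x = 0) (ha : 0 < a)
    (hab : a < b) (h1 : ∫ x, φ x = 1) {G : ℝ} (hG : 0 < G) (t : ℝ) :
    convZ (plateauFourier φ b) G t - G * hardyZ t =
      ∫ x : ℝ, (hardyZ (t + x) - hardyZ t) * plateauFourier φ b (x / G) := by
  have hb := ha.trans hab
  have e : ∫ x : ℝ, hardyZ t * plateauFourier φ b (x / G) = G * hardyZ t := by
    rw [integral_const_mul, Measure.integral_comp_div, integral_plateauFourier hφ hs ha hab, h1,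
      abs_of_pos hG, Complex.ofReal_one, Complex.real_smul, mul_one, mul_comm]
  rw [convZ, ← e, ← integral_sub (integrable_hardyZ_mul_plateauFourier hφ hs hb hG t)
    (integrable_const_mul_plateauFourier hφ hs hb hG _)]
  simp only [sub_mul]

lemma exists_norm_tail_le (hφ : ContDiff ℝ ∞ φ) (hs : ∀ x, a ≤ |x| → φ x = 0) (hb : 0 < b)
    (n : ℕ) : ∃ C : ℝ, 0 ≤ C ∧ ∀ t G : ℝ, 2 ≤ t → 0 < G → G ≤ 1 →
      ‖∫ x in (Set.Ioc (-(t / 2)) (t / 2))ᶜ,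
        (hardyZ (t + x) - hardyZ t) * plateauFourier φ b (x / G)‖ ≤ G * (C * (1 / t) ^ n) := by
  obtain ⟨C, hC, h⟩ := exists_abs_pow_mul_norm_plateauFourier_le hφ hs hb (n + 3)
  refine ⟨56 * C * Real.pi * 2 ^ n, by have := Real.pi_pos; positivity,
    fun t G ht hG hG1 => ?_⟩
  have hpt : ∀ x ∈ (Set.Ioc (-(t / 2)) (t / 2))ᶜ,
      ‖(hardyZ (t + x) - hardyZ t) * plateauFourier φ b (x / G)‖ ≤
        56 * C * G * (2 / t) ^ n * (1 + x ^ 2)⁻¹ := by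
    intro x hx
    have hx' : t / 2 ≤ |x| := by
      by_contra hlt
      rw [not_le, abs_lt] at hlt
      exact hx ⟨hlt.1, hlt.2.le⟩
    have hx1 : 1 ≤ |x| := by linarith
    have hx0 : 0 < |x| := by linarith
    have hZ : ‖hardyZ (t + x) - hardyZ t‖ ≤ 28 * |x| := by
      refine (norm_sub_le _ _).trans ?_
      have i1 := norm_hardyZ_le (t + x)
      have i2 := norm_hardyZ_le t
      have i3 := abs_add_le t x
      rw [abs_of_nonneg (by linarith : 0 ≤ t)] at i2 i3
      linarith
    have hf : ‖plateauFourier φ b (x / G)‖ ≤ C * G / |x| ^ (n + 3) := by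
      have := h (x / G)
      rw [abs_div, abs_of_pos hG, div_pow, div_mul_eq_mul_div, div_le_iff₀ (by positivity)] at this
      rw [le_div_iff₀ (by positivity), mul_comm]
      refine this.trans ?_
      gcongr
      exact pow_le_of_le_one hG.le hG1 (by omega)
    rw [norm_mul]
    calc _ ≤ (28 * |x|) * (C * G / |x| ^ (n + 3)) := by gcongr
      _ = 28 * C * G * (1 / |x|) ^ n * (1 / |x| ^ 2) := by
          rw [pow_add, one_div_pow]; field_simp
      _ ≤ 28 * C * G * (2 / t) ^ n * (2 * (1 + x ^ 2)⁻¹) := by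
          have j1 : 1 / |x| ≤ 2 / t := by
            rw [div_le_div_iff₀ hx0 (by linarith)]; linarith
          have j2 : 1 / |x| ^ 2 ≤ 2 * (1 + x ^ 2)⁻¹ := by
            rw [sq_abs, ← div_eq_mul_inv, div_le_div_iff₀ (by rw [← sq_abs]; positivity)
              (by positivity)]
            have : 1 ≤ x ^ 2 := by rw [← sq_abs]; exact one_le_pow₀ hx1
            linarith
          gcongr
      _ = _ := by ring
  have hcpos : 0 ≤ 56 * C * G * (2 / t) ^ n := by positivity
  have hint : Integrable fun x : ℝ => 56 * C * G * (2 / t) ^ n * (1 + x ^ 2)⁻¹ :=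
    integrable_inv_one_add_sq.const_mul _
  calc _ ≤ ∫ x in (Set.Ioc (-(t / 2)) (t / 2))ᶜ, 56 * C * G * (2 / t) ^ n * (1 + x ^ 2)⁻¹ :=
        norm_integral_le_of_norm_le hint.integrableOn
          ((ae_restrict_iff' measurableSet_Ioc.compl).2 (Filter.Eventually.of_forall hpt))
    _ ≤ ∫ x : ℝ, 56 * C * G * (2 / t) ^ n * (1 + x ^ 2)⁻¹ :=
        setIntegral_le_integral hint (Filter.Eventually.of_forall fun x => by
          show (0 : ℝ) ≤ _
          positivity)
    _ = _ := by
        rw [integral_const_mul, integral_univ_inv_one_add_sq, div_pow, one_div_pow]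
        ring

/-- The part `|x| ≤ t/2` of the integral. There the integrand is
`(G / 2πi) (conj P - P)` with `P(z) = (F(z) - F(0)) / z · φ̂(z/G) e^{-2πibz/G}`, where `F` continues
`x ↦ Z(t + x)`; the conjugation symmetry leaves only one contour shift, into the lower
half-plane. -/
lemma exists_norm_central_le (hφ : ContDiff ℝ ∞ φ) (he : ∀ x, φ (-x) = φ x)
    (hs : ∀ x, a ≤ |x| → φ x = 0) (ha : 0 < a) (hab : a < b) (n : ℕ) :
    ∃ C : ℝ, 0 ≤ C ∧ ∀ t G : ℝ, 4 * (n + 3) + 2 ≤ t → 0 < G → G ≤ 1 →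
      Real.exp (-(2 * Real.pi * (b - a) * (2 * (n + 3)) / G)) ≤
        (4 * Real.pi / t) ^ (2 * (n + 3)) →
      ‖∫ x in (-(t / 2))..(t / 2),
        (hardyZ (t + x) - hardyZ t) * plateauFourier φ b (x / G)‖ ≤ G * (C * (1 / t) ^ n) := by
  have hb := ha.trans hab
  have hts := tsupport_subset_Icc_of_eq_zero hs
  obtain ⟨C₁, hC₁, hcont⟩ := exists_hardyZ_continuation (n + 3)
  obtain ⟨C₀, hC₀, hφ₀⟩ := exists_pow_mul_norm_fourierLaplace_le 0 hφ hts
  -- `2n + 5` powers of `1/t` cancel the growth `t ^ (n + 5)` of `Z` and leave `t ^ (-n)`.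
  obtain ⟨C₂, hC₂, hφ₂⟩ := exists_pow_mul_norm_fourierLaplace_le (2 * n + 5) hφ hts
  have hπ := Real.pi_pos
  refine ⟨2 * C₁ * 3 ^ (n + 5) * C₀ * (4 * Real.pi) ^ (2 * (n + 3)) +
    8 * (n + 3) * C₁ * 3 ^ (n + 5) * C₂ * 2 ^ (2 * n + 5), by positivity,
    fun t G ht hG hG1 hexp => ?_⟩
  have hn0 : (0 : ℝ) ≤ n := Nat.cast_nonneg n
  have ht0 : 0 < t := by linarith
  obtain ⟨F, hFd, hFZ, hFb⟩ := hcont t ht0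
  set X : ℝ := t / 2 with hX
  set Y : ℝ := 2 * (n + 3) with hY
  set H : ℝ := C₁ * (3 * t) ^ (n + 5) with hH
  have hX1 : 1 ≤ X := by rw [hX]; linarith
  have hY1 : 1 ≤ Y := by rw [hY]; linarith
  have hYX : Y + 1 ≤ X := by rw [hX, hY]; linarith
  have hH0 : 0 ≤ H := by positivity
  have hnorm : ∀ z : ℂ, |z.re| ≤ X → |z.im| ≤ Y → ‖z‖ < t := by
    intro z h1 h2
    have := Complex.norm_le_abs_re_add_abs_im z
    rw [hX] at *
    linarith
  have hball : ∀ z : ℂ, ‖z‖ < t → (t : ℂ) + z ∈ Metric.ball (t : ℂ) t := by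
    intro z hz
    rwa [mem_ball_iff_norm, add_sub_cancel_left]
  have hFH : ∀ z : ℂ, |z.re| ≤ X → -Y ≤ z.im → z.im ≤ 0 → ‖F (t + z)‖ ≤ H := by
    intro z h1 h2 h3
    have hz : ‖z‖ < t := hnorm z h1 (abs_le.2 ⟨h2, by linarith⟩)
    refine (hFb _ (hball z hz) ?_ ?_ ?_).trans ?_
    · rw [Complex.add_re, Complex.ofReal_re]
      have := (abs_le.1 h1).1
      rw [hX] at *
      linarith
    · rw [Complex.add_im, Complex.ofReal_im, zero_add]
      push_cast
      exact h2
    · simpa using h3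
    · rw [hH]
      gcongr
      have := norm_add_le (t : ℂ) z
      rw [Complex.norm_real, Real.norm_of_nonneg ht0.le] at this
      linarith
  set D : ℂ → ℂ := dslope (fun z => F (t + z)) 0 with hD
  have hDd : DifferentiableOn ℂ D (Metric.ball 0 t) := by
    rw [hD, Complex.differentiableOn_dslope (Metric.ball_mem_nhds 0 ht0)]
    refine hFd.comp (by fun_prop) fun z hz => hball z ?_
    rwa [mem_ball_zero_iff] at hz
  have hD_ne : ∀ z : ℂ, z ≠ 0 → D z = (F (t + z) - F t) / z := by
    intro z hz
    rw [hD, dslope_of_ne _ hz, slope_def_field, add_zero, sub_zero]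
  have hDH : ∀ z : ℂ, |z.re| ≤ X → -Y ≤ z.im → z.im ≤ 0 → 1 ≤ ‖z‖ → ‖D z‖ ≤ 2 * H := by
    intro z h1 h2 h3 h4
    rw [hD_ne z (norm_pos_iff.1 (by linarith)), norm_div]
    refine (div_le_self (norm_nonneg _) h4).trans ((norm_sub_le _ _).trans ?_)
    have i1 := hFH z h1 h2 h3
    have i2 := hFH 0 (by simp; linarith) (by simp; linarith) (by simp)
    rw [add_zero] at i2
    linarith
  have hGc : (G : ℂ) ≠ 0 := by exact_mod_cast hG.ne'
  set P : ℂ → ℂ := fun z => D z * fourierLaplace φ (z / G) *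
    Complex.exp (-(2 * Real.pi * Complex.I * (z / G) * b)) with hP
  have hPd : DifferentiableOn ℂ P (Metric.ball 0 t) := by
    have h1 : Differentiable ℂ fun z : ℂ => fourierLaplace φ (z / G) :=
      (differentiable_fourierLaplace hφ.continuous hts).comp (by fun_prop)
    have h2 : Differentiable ℂ fun z : ℂ =>
      Complex.exp (-(2 * Real.pi * Complex.I * (z / G) * b)) := by fun_prop
    exact (hDd.mul h1.differentiableOn).mul h2.differentiableOn
  have him : ∀ z : ℂ, (z / (G : ℂ)).im = z.im / G := fun z => Complex.div_ofReal_im z G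
  -- The factor `e^{2πa|y|/G}` lost in the transform is absorbed by `e^{-2πb|y|/G}`.
  have hfac : ∀ (z : ℂ) (c k : ℝ), z.im ≤ 0 →
      c * ‖fourierLaplace φ (z / G)‖ ≤ k * Real.exp (2 * Real.pi * a * |(z / (G : ℂ)).im|) →
      c * ‖fourierLaplace φ (z / G) *
        Complex.exp (-(2 * Real.pi * Complex.I * (z / G) * b))‖ ≤
        k * Real.exp (-(2 * Real.pi * (b - a) * (-z.im) / G)) := by
    intro z c k hz h
    rw [norm_mul, norm_exp_neg_two_pi_I_mul, ← mul_assoc]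
    refine (mul_le_mul_of_nonneg_right h (Real.exp_pos _).le).trans (le_of_eq ?_)
    rw [mul_assoc, ← Real.exp_add, him, abs_div, abs_of_pos hG, abs_of_nonpos hz]
    congr 2
    ring
  have hbound₁ : ∀ x : ℝ, |x| ≤ X → ‖P (x + (-Y : ℝ) * Complex.I)‖ ≤
      2 * H * (C₀ * (4 * Real.pi / t) ^ (2 * (n + 3))) := by
    intro x hx
    set z : ℂ := x + (-Y : ℝ) * Complex.I with hz
    have hre : z.re = x := by simp [hz]
    have hzi : z.im = -Y := by simp [hz]
    have hz1 : 1 ≤ ‖z‖ := by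
      refine le_trans ?_ (Complex.abs_im_le_norm z)
      rw [hzi, abs_neg]
      exact hY1.trans (le_abs_self Y)
    simp only [hP]
    rw [mul_assoc, norm_mul]
    have i1 := hDH z (by rwa [hre]) hzi.ge (by rw [hzi]; linarith) hz1
    have i2 := hfac z 1 C₀ (by rw [hzi]; linarith) (by simpa using hφ₀ (z / G))
    rw [one_mul, hzi, neg_neg] at i2
    gcongr
    exact i2.trans (by gcongr)
  have hbound₂ : ∀ x y : ℝ, |x| = X → -Y ≤ y → y ≤ 0 → ‖P (x + y * Complex.I)‖ ≤
      2 * H * (C₂ * (2 / t) ^ (2 * n + 5)) := by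
    intro x y hx hy hy0
    set z : ℂ := x + y * Complex.I with hz
    have hre : z.re = x := by simp [hz]
    have hzi : z.im = y := by simp [hz]
    have hzX : X ≤ ‖z‖ := by
      refine le_trans ?_ (Complex.abs_re_le_norm z)
      rw [hre, hx]
    simp only [hP]
    rw [mul_assoc, norm_mul]
    have i1 := hDH z (by rw [hre, hx]) (by rwa [hzi]) (by rwa [hzi]) (hX1.trans hzX)
    have i2 := hfac z (‖z / (G : ℂ)‖ ^ (2 * n + 5)) C₂ (by rwa [hzi]) (hφ₂ (z / G))
    have i3 : X ≤ ‖z / (G : ℂ)‖ := by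
      rw [norm_div, Complex.norm_real, Real.norm_of_nonneg hG.le, le_div_iff₀ hG]
      nlinarith
    have i4 : Real.exp (-(2 * Real.pi * (b - a) * (-z.im) / G)) ≤ 1 := by
      rw [Real.exp_le_one_iff, neg_nonpos, hzi]
      have : 0 ≤ b - a := by linarith
      have : 0 ≤ -y := by linarith
      positivity
    gcongr
    have i5 : X ^ (2 * n + 5) * ‖fourierLaplace φ (z / G) *
        Complex.exp (-(2 * Real.pi * Complex.I * (z / G) * b))‖ ≤ C₂ := by
      calc _ ≤ ‖z / (G : ℂ)‖ ^ (2 * n + 5) * _ := by gcongr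
        _ ≤ _ := i2
        _ ≤ C₂ * 1 := by gcongr
        _ = C₂ := mul_one _
    have i6 : (2 / t) = 1 / X := by rw [hX]; field_simp
    rw [i6, one_div_pow, mul_one_div, le_div_iff₀ (by positivity), mul_comm]
    exact i5
  have hrect : Set.uIcc (-X) X ×ℂ Set.uIcc 0 (-Y) ⊆ Metric.ball 0 t := by
    intro z hz
    rw [Complex.mem_reProdIm, Set.uIcc_of_le (by linarith), Set.uIcc_of_ge (by linarith)] at hz
    rw [mem_ball_zero_iff]
    exact hnorm z (abs_le.2 hz.1) (abs_le.2 ⟨hz.2.1, by linarith [hz.2.2]⟩)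
  have hJ := norm_integral_le_of_shift_down (by linarith) (by linarith) (hPd.mono hrect)
    hbound₁ hbound₂
  set J : ℂ := ∫ x : ℝ in (-X)..X, P x with hJdef
  have hPc : ContinuousOn (fun x : ℝ => P x) (Set.uIcc (-X) X) := by
    refine (hPd.mono hrect).continuousOn.comp Complex.continuous_ofReal.continuousOn fun x hx => ?_
    rw [Complex.mem_reProdIm]
    simpa using hx
  have hPi : IntervalIntegrable (fun x : ℝ => P x) volume (-X) X := hPc.intervalIntegrable
  have hPic : IntervalIntegrable (fun x : ℝ => conj (P x)) volume (-X) X :=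
    (Complex.continuous_conj.comp_continuousOn hPc).intervalIntegrable
  have hmain : ∫ x in (-X)..X, (hardyZ (t + x) - hardyZ t) * plateauFourier φ b (x / G) =
      G / (2 * Real.pi * Complex.I) * (conj J - J) := by
    rw [hJdef, ← intervalIntegral.intervalIntegral_conj, ← intervalIntegral.integral_sub hPic hPi,
      ← intervalIntegral.integral_const_mul]
    refine intervalIntegral.integral_congr_ae ?_
    have hne : ∀ᵐ x : ℝ, x ≠ 0 := by simp [ae_iff]
    filter_upwards [hne] with x hx0 hx
    rw [Set.uIoc_of_le (by linarith)] at hx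
    have hxX : |x| ≤ X := abs_le.2 ⟨hx.1.le, hx.2⟩
    have hxc : (x : ℂ) ≠ 0 := by exact_mod_cast hx0
    have hDx : D x = (hardyZ (t + x) - hardyZ t) / x := by
      have j1 := hFZ (t + x) (by
        push_cast
        exact hball x (hnorm x (by simpa using hxX) (by simp; linarith)))
      have j2 := hFZ t (Metric.mem_ball_self ht0)
      rw [hD_ne _ hxc, ← j1, ← j2]
      push_cast
      rfl
    have hDconj : conj (D x) = D x := by
      rw [hDx, map_div₀, map_sub, conj_hardyZ, conj_hardyZ, Complex.conj_ofReal]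
    have hPhi : conj (fourierLaplace φ ((x : ℂ) / G)) = fourierLaplace φ ((x : ℂ) / G) := by
      have := conj_fourierLaplace_of_even he (x / G)
      push_cast at this
      exact this
    have hconjP : conj (P x) = D x * fourierLaplace φ (x / G) *
        Complex.exp (2 * Real.pi * Complex.I * (x / G) * b) := by
      simp only [hP, map_mul, hDconj, hPhi, ← Complex.exp_conj]
      congr 2
      simp [map_ofNat]
    have hf := mul_plateauFourier hφ hs hb (x / G)
    push_cast at hf
    have hπc : (Real.pi : ℂ) ≠ 0 := by exact_mod_cast Real.pi_ne_zero
    have hI := Complex.I_ne_zero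
    rw [hconjP]
    simp only [hP]
    rw [hDx]
    generalize Complex.exp (2 * Real.pi * Complex.I * (x / G) * b) = e₁ at hf ⊢
    generalize Complex.exp (-(2 * Real.pi * Complex.I * (x / G) * b)) = e₂ at hf ⊢
    generalize fourierLaplace φ ((x : ℂ) / G) = p at hf ⊢
    have hf' : plateauFourier φ b (x / G) =
        G / (2 * Real.pi * Complex.I * x) * ((e₁ - e₂) * p) := by
      rw [← hf]
      field_simp
    rw [hf']
    field_simp
  have hJle : ‖(G : ℂ) / (2 * Real.pi * Complex.I) * (conj J - J)‖ ≤ G * ‖J‖ := by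
    rw [norm_mul, norm_div, norm_mul, norm_mul, Complex.norm_I, Complex.norm_real,
      Complex.norm_real, Complex.norm_two, Real.norm_of_nonneg hG.le, Real.norm_of_nonneg hπ.le,
      mul_one]
    have h1 : ‖conj J - J‖ ≤ 2 * ‖J‖ := by
      refine (norm_sub_le _ _).trans ?_
      rw [RCLike.norm_conj]
      linarith
    calc _ ≤ G / (2 * Real.pi) * (2 * ‖J‖) := by gcongr
      _ = G * ‖J‖ / Real.pi := by field_simp
      _ ≤ G * ‖J‖ := div_le_self (by positivity) (by linarith [Real.pi_gt_three])
  rw [hmain]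
  refine hJle.trans (mul_le_mul_of_nonneg_left (hJ.trans (le_of_eq ?_)) hG.le)
  rw [hX, hY, hH]
  have ep1 : t ^ (2 * (n + 3)) = t * t ^ (n + 5) * t ^ n := by ring
  have ep2 : t ^ (2 * n + 5) = t ^ (n + 5) * t ^ n := by ring
  simp only [div_pow, mul_pow 3 t, ep1, ep2, one_pow]
  field_simp
  ring

/-- The approximation for a single pair `t`, `G`. The hypothesis on the exponential says that `G`
is small enough, `1/G ≍ log t`, for the contour shift to beat the growth of `Z`. -/
lemma exists_norm_convZ_sub_le (hφ : ContDiff ℝ ∞ φ) (he : ∀ x, φ (-x) = φ x)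
    (hs : ∀ x, a ≤ |x| → φ x = 0) (ha : 0 < a) (hab : a < b) (h1 : ∫ x, φ x = 1) (n : ℕ) :
    ∃ C : ℝ, 0 ≤ C ∧ ∀ t G : ℝ, 4 * (n + 3) + 2 ≤ t → 0 < G → G ≤ 1 →
      Real.exp (-(2 * Real.pi * (b - a) * (2 * (n + 3)) / G)) ≤
        (4 * Real.pi / t) ^ (2 * (n + 3)) →
      ‖convZ (plateauFourier φ b) G t - G * hardyZ t‖ ≤ G * (C * (1 / t) ^ n) := by
  have hb := ha.trans hab
  obtain ⟨C₁, hC₁, hin⟩ := exists_norm_central_le hφ he hs ha hab n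
  obtain ⟨C₂, hC₂, hout⟩ := exists_norm_tail_le hφ hs hb n
  refine ⟨C₁ + C₂, by positivity, fun t G ht hG hG1 hexp => ?_⟩
  have ht2 : 2 ≤ t := by linarith [(Nat.cast_nonneg n : (0 : ℝ) ≤ n)]
  have hint : Integrable fun x : ℝ =>
      (hardyZ (t + x) - hardyZ t) * plateauFourier φ b (x / G) := by
    simp only [sub_mul]
    exact (integrable_hardyZ_mul_plateauFourier hφ hs hb hG t).sub
      (integrable_const_mul_plateauFourier hφ hs hb hG _)
  have i1 := hin t G ht hG hG1 hexp
  have i2 := hout t G ht2 hG hG1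
  rw [convZ_sub_eq hφ hs ha hab h1 hG, ← integral_add_compl
    (measurableSet_Ioc (a := -(t / 2)) (b := t / 2)) hint,
    ← intervalIntegral.integral_of_le (by linarith)]
  refine (norm_add_le _ _).trans ((add_le_add i1 i2).trans (le_of_eq ?_))
  ring

end Convolution

theorem theorem1 (α : ℝ) (hα : 1 < α) (φ : ℝ → ℝ) (hφ : GelfandShilov 0 α φ)
    (hφ_even : ∀ x, φ (-x) = φ x) (hφ_nonneg : ∀ x, 0 ≤ φ x)
    (hφ_int : (∫ x, φ x) = 1)
    (a : ℝ) (ha : 0 < a) (hφ_supp : ∀ x, a ≤ |x| → φ x = 0)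
    (b : ℝ) (hb : max 1 a < b)
    (δ : ℝ) (hδ : 0 < δ) (hδ' : δ < 2 * Real.pi * (b - a))
    (ε : ℝ) (hε : 0 < ε) (N : ℝ) (hN : 1 ≤ N) :
    ∃ C T₀ : ℝ, ∀ T : ℝ, T₀ ≤ T → ∀ V : ℝ,
      (Real.log T) ^ ε ≤ V → V ≤ T ^ (1 / 4 : ℝ) / Real.log T →
      ∀ t : ℝ, |t - T| ≤ V * (Real.log T) ^ (1 / 2 + ε) →
      ∀ G : ℝ, G = δ / Real.log (T / (2 * Real.pi)) →
        Integrable (fun x : ℝ => hardyZ (t + x) * plateauFourier φ b (x / G)) ∧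
        ‖convZ (plateauFourier φ b) G t - G * hardyZ t‖ ≤ G * (C * T ^ (-N)) := by
  have hab : a < b := (le_max_right 1 a).trans_lt hb
  have hb0 : 0 < b := ha.trans hab
  have hπ := Real.pi_pos
  set n : ℕ := ⌈N⌉₊ with hn
  obtain ⟨C, hC, hmain⟩ := exists_norm_convZ_sub_le hφ.1 hφ_even hφ_supp ha hab hφ_int n
  -- The window `|t - T| ≤ V (log T)^{1/2 + ε}` is contained in `|t - T| ≤ T / 2`.
  have ev₁ : ∀ᶠ T : ℝ in Filter.atTop,
      (Real.log T) ^ (1 / 2 + ε) ≤ 1 / 2 * T ^ (3 / 4 : ℝ) := by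
    filter_upwards [(isLittleO_log_rpow_rpow_atTop (1 / 2 + ε)
      (by norm_num : (0 : ℝ) < 3 / 4)).bound (by norm_num : (0 : ℝ) < 1 / 2),
      Filter.eventually_ge_atTop 1] with T hT hT1
    rw [Real.norm_of_nonneg (Real.rpow_nonneg (Real.log_nonneg hT1) _),
      Real.norm_of_nonneg (Real.rpow_nonneg (by linarith) _)] at hT
    exact hT
  have ev : ∀ᶠ T : ℝ in Filter.atTop, (Real.log T) ^ (1 / 2 + ε) ≤ 1 / 2 * T ^ (3 / 4 : ℝ) ∧
      Real.exp 1 ≤ T ∧ 2 * Real.pi * Real.exp δ ≤ T ∧ 2 * (4 * ((n : ℝ) + 3) + 2) ≤ T :=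
    ev₁.and ((Filter.eventually_ge_atTop _).and
      ((Filter.eventually_ge_atTop _).and (Filter.eventually_ge_atTop _)))
  obtain ⟨T₀, hT₀⟩ := Filter.eventually_atTop.1 ev
  refine ⟨C * 2 ^ n, T₀, fun T hT V _ hV t ht G hG => ?_⟩
  obtain ⟨hL, hTe, hTδ, hTn⟩ := hT₀ T hT
  have hn0 : (0 : ℝ) ≤ n := Nat.cast_nonneg n
  have hT1 : 1 ≤ T := by linarith
  have hT0 : 0 < T := by linarith
  have hlogT : 1 ≤ Real.log T := by
    rw [Real.le_log_iff_exp_le hT0]; exact hTe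
  have htT : |t - T| ≤ T / 2 := by
    calc |t - T| ≤ V * (Real.log T) ^ (1 / 2 + ε) := ht
      _ ≤ T ^ (1 / 4 : ℝ) * (1 / 2 * T ^ (3 / 4 : ℝ)) := by
          refine mul_le_mul (hV.trans (div_le_self (by positivity) hlogT)) hL
            (by positivity) (by positivity)
      _ = T / 2 := by
          rw [mul_left_comm, ← Real.rpow_add hT0]
          norm_num
          ring
  obtain ⟨htl, htu⟩ := abs_le.1 htT
  have ht0 : 0 < t := by linarith
  set ℓ : ℝ := Real.log (T / (2 * Real.pi)) with hℓ
  have hℓδ : δ ≤ ℓ := by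
    rw [hℓ, Real.le_log_iff_exp_le (by positivity), le_div_iff₀ (by positivity)]
    linarith
  have hℓ0 : 0 < ℓ := hδ.trans_le hℓδ
  have hG0 : 0 < G := by rw [hG]; positivity
  have hG1 : G ≤ 1 := by rw [hG, div_le_one hℓ0]; exact hℓδ
  refine ⟨integrable_hardyZ_mul_plateauFourier hφ.1 hφ_supp hb0 hG0 t, ?_⟩
  have hexp : Real.exp (-(2 * Real.pi * (b - a) * (2 * (n + 3)) / G)) ≤
      (4 * Real.pi / t) ^ (2 * (n + 3)) := by
    have e1 : Real.exp (-ℓ) = 2 * Real.pi / T := by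
      rw [hℓ, Real.exp_neg, Real.exp_log (by positivity), inv_div]
    calc Real.exp (-(2 * Real.pi * (b - a) * (2 * (n + 3)) / G))
        ≤ Real.exp ((2 * (n + 3) : ℕ) * -ℓ) := by
          apply Real.exp_le_exp.2
          have e2 : 2 * Real.pi * (b - a) * (2 * ((n : ℝ) + 3)) / G =
              (2 * Real.pi * (b - a) / δ) * ((2 * ((n : ℝ) + 3)) * ℓ) := by
            rw [hG]; field_simp
          -- This is where the hypothesis `δ < 2π(b - a)` enters.
          have e3 : 1 ≤ 2 * Real.pi * (b - a) / δ := by rw [one_le_div hδ]; exact hδ'.le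
          rw [e2]
          push_cast
          have e4 : 0 ≤ (2 * ((n : ℝ) + 3)) * ℓ := by positivity
          nlinarith
      _ = (2 * Real.pi / T) ^ (2 * (n + 3)) := by rw [Real.exp_nat_mul, e1]
      _ ≤ (4 * Real.pi / t) ^ (2 * (n + 3)) := by
          refine pow_le_pow_left₀ (by positivity) ?_ _
          rw [div_le_div_iff₀ hT0 ht0]
          nlinarith
  refine (hmain t G (by linarith) hG0 hG1 hexp).trans ?_
  have hpow : (1 / t) ^ n ≤ 2 ^ n * T ^ (-N) := by
    calc (1 / t) ^ n ≤ (2 / T) ^ n := by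
          refine pow_le_pow_left₀ (by positivity) ?_ _
          rw [div_le_div_iff₀ ht0 hT0]
          linarith
      _ = 2 ^ n * T ^ (-(n : ℝ)) := by
          rw [div_pow, Real.rpow_neg hT0.le, Real.rpow_natCast, div_eq_mul_inv]
      _ ≤ 2 ^ n * T ^ (-N) := by
          refine mul_le_mul_of_nonneg_left (Real.rpow_le_rpow_of_exponent_le hT1 ?_)
            (by positivity)
          exact neg_le_neg (Nat.le_ceil N)
  rw [mul_assoc C]
  gcongr
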